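/- Let $n\ge 0$ and $d=2^n$. For $x\in\mathbb F_2^n$ let $E_x=|x\rangle\langle x|$, let $(A|B)=\mathrm{Tr}(A^\dagger B)$, let $\omega(g)(A)=gAg^\dagger$, and let $M(A)=\sum_x (E_x|A)\,E_x$. Write $\sigma_a=\sigma_{a_1}\otimes\cdots\otimes\sigma_{a_n}$, $a\in(\mathbb F_2^2)^n$, for the Pauli operators and $\mathrm{supp}(a)=\{i: a_i\ne 0\}$. Let $G$ be either the global Clifford group $\mathrm{Cl}_n\subset U(d)$, i.e. the group generated by the Hadamard and phase gates on all qubits and the controlled-NOT gates on all ordered pairs of distinct qubits, or the local Clifford group $\mathrm{Cl}_1^{\times n}$, acting by $g_1\otimes\cdots\otimes g_n$. Both are finite; let $g$ be uniformly distributed on $G$. The frame operator $S=\mathbb E_g[\omega(g)^\dagger M\,\omega(g)]$ is invertible, and the shadow estimator of a Hermitian observable $O$ is $\hat o(g,x)=(O|S^{-1}\omega(g)^\dagger|E_x)$. Let the noise be gate-dependent: $\Lambda(g)$ is an arbitrary quantum channel (completely positive and trace preserving) for each $g\in G$. For an arbitrary quantum state $\rho$ and given $g$, the outcome $x$ is obtained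 with probability $(E_x|\omega(g)\Lambda(g)|\rho)$, and $\mathbb V[\hat o]=\mathbb E|\hat o-\mathbb E\hat o|^2$ is the variance of $\hat o(g,x)$ under the resulting joint distribution of $(g,x)$. Put $O_0=O-\mathrm{Tr}(O)\mathbb 1/d$, $\|A\|_{\mathrm{st}}=\frac1d\sum_a|(\sigma_a|A)|$, $\|A\|_2=\sqrt{(A|A)}$, and let $\|A\|_\infty$ be the spectral norm. Then: 1. For uniform sampling from the global Clifford group, $$\mathbb V_{\mathrm{global}}[\hat o]\le \frac{2(d+1)}{d+2}\,\|O_0\|_{\mathrm{st}}^2+\frac{d+1}{d}\,\|O_0\|_2^2 .$$ 2. For uniform sampling from the local Clifford group, $$\mathbb V_{\mathrm{loc}}[\hat o]\le 4^k\,\|O_{\mathrm{loc}}\|_\infty^2$$ if $O$ acts as a Hermitian operator $O_{\mathrm{loc}}$ on some $k$ of the qubits and as the identity on the others (for example $O=O_{\mathrm{loc}}\otimes\mathbb 1^{\otimes(n-k)}$), and $$\mathbb V_{\mathrm{loc}}[\hat o]\le 3^{|\mathrm{supp}(a)|}$$ if $O=\sigma_a$ is a Pauli operator. -/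

import Mathlib

open scoped Matrix ComplexOrder

/-! ### Registers of qubits and operators on them -/

/-- Labels `x ∈ 𝔽₂ⁿ` of the computational basis (addition in `Fin 2` is modulo 2). -/
abbrev Bits (n : ℕ) : Type := Fin n → Fin 2

/-- Linear operators on `n` qubits, as matrices in the computational basis. -/
abbrev Op (n : ℕ) : Type := Matrix (Bits n) (Bits n) ℂ

/-- Superoperators: linear maps on the space of operators. -/
abbrev SuperOp (n : ℕ) : Type := Module.End ℂ (Op n)

/-- The tensor product `A₁ ⊗ ⋯ ⊗ Aₙ` of single-qubit operators. -/
def tensorOp {n : ℕ} (A : Fin n → Matrix (Fin 2) (Fin 2) ℂ) : Op n :=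
  Matrix.of fun x y => ∏ i, A i (x i) (y i)

/-- The operator acting as `A` on qubit `i` and as the identity on all other qubits. -/
def onQubit {n : ℕ} (i : Fin n) (A : Matrix (Fin 2) (Fin 2) ℂ) : Op n :=
  tensorOp (Function.update (fun _ => 1) i A)

/-! ### Pauli operators -/

/-- Labels of single-qubit Pauli operators, `𝔽₂²`. -/
abbrev PauliLabel : Type := Fin 2 × Fin 2

/-- `σ₀₀ = 1`, `σ₀₁ = X`, `σ₁₁ = Y`, `σ₁₀ = Z`. -/
def pauli1 : PauliLabel → Matrix (Fin 2) (Fin 2) ℂ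
  | (0, 0) => 1
  | (0, 1) => !![0, 1; 1, 0]
  | (1, 1) => !![0, -Complex.I; Complex.I, 0]
  | (1, 0) => !![1, 0; 0, -1]

/-- `σ_a = σ_{a₁} ⊗ ⋯ ⊗ σ_{aₙ}`. -/
def pauli {n : ℕ} (a : Fin n → PauliLabel) : Op n := tensorOp fun i => pauli1 (a i)

/-- The support of a Pauli label: the qubits on which `σ_a` is not the identity. -/
def pauliSupport {n : ℕ} (a : Fin n → PauliLabel) : Finset (Fin n) :=
  Finset.univ.filter fun i => a i ≠ (0, 0)

/-! ### The Clifford group -/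

/-- The Hadamard gate. -/
noncomputable def hadamardGate : Matrix (Fin 2) (Fin 2) ℂ :=
  ((1 / Real.sqrt 2 : ℝ) : ℂ) • !![1, 1; 1, -1]

/-- The phase gate. -/
def phaseGate : Matrix (Fin 2) (Fin 2) ℂ := !![1, 0; 0, Complex.I]

/-- The map `x_j ↦ x_j + x_i` on basis labels. -/
def cnotMap {n : ℕ} (i j : Fin n) (x : Bits n) : Bits n := Function.update x j (x j + x i)

/-- The controlled-NOT gate with control `i` and target `j`. -/
def cnotGate {n : ℕ} (i j : Fin n) : Op n :=
  Matrix.of fun x y => if x = cnotMap i j y then 1 else 0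

/-- Hadamard and phase gates on every qubit, controlled-NOT gates on every ordered pair of
distinct qubits. -/
def cliffordGenerators (n : ℕ) : Set (Op n) :=
  {A | (∃ i, A = onQubit i hadamardGate) ∨ (∃ i, A = onQubit i phaseGate) ∨
    ∃ i j, i ≠ j ∧ A = cnotGate i j}

/-- The `n`-qubit Clifford group: the subgroup of `U(2ⁿ)` generated by the Hadamard, phase and
controlled-NOT gates. -/
def cliffordGroup (n : ℕ) : Subgroup (Matrix.unitaryGroup (Bits n) ℂ) :=
  Subgroup.closure {U | (U : Op n) ∈ cliffordGenerators n}

/-- The unitary matrix of an element of the Clifford group. -/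
def cliffordUnitary {n : ℕ} (g : cliffordGroup n) : Op n :=
  ((g : Matrix.unitaryGroup (Bits n) ℂ) : Op n)

/-- The local Clifford group `Cl₁ × ⋯ × Cl₁` (`n` factors). -/
abbrev LocalClifford (n : ℕ) : Type := Fin n → cliffordGroup 1

/-- The unitary `g₁ ⊗ ⋯ ⊗ gₙ` of an element `(g₁, …, gₙ)` of the local Clifford group. -/
def localCliffordUnitary {n : ℕ} (g : LocalClifford n) : Op n :=
  tensorOp fun i => Matrix.of fun s t => cliffordUnitary (g i) (fun _ => s) (fun _ => t)

/-! ### Finiteness of the Clifford group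

The group is finite, because it acts by conjugation on the finite set of Pauli operators with
phases, the kernel of this action consists of scalars, and determinants are fourth roots of
unity. -/

theorem tensorOp_mul {n : ℕ} (A B : Fin n → Matrix (Fin 2) (Fin 2) ℂ) :
    tensorOp A * tensorOp B = tensorOp fun i => A i * B i := by
  ext x y
  simp only [tensorOp, Matrix.mul_apply, Matrix.of_apply]
  rw [Finset.prod_univ_sum, Fintype.piFinset_univ]
  exact Finset.sum_congr rfl fun z _ => by rw [Finset.prod_mul_distrib]

theorem tensorOp_one {n : ℕ} : tensorOp (fun _ : Fin n => 1) = 1 := by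
  ext x y
  simp only [tensorOp, Matrix.of_apply, Matrix.one_apply, Finset.prod_ite_zero]
  simp [funext_iff]

theorem tensorOp_conjTranspose {n : ℕ} (A : Fin n → Matrix (Fin 2) (Fin 2) ℂ) :
    (tensorOp A)ᴴ = tensorOp fun i => (A i)ᴴ := by
  ext x y
  simp [tensorOp, Matrix.conjTranspose_apply]

theorem onQubit_mul {n : ℕ} (i : Fin n) (A B : Matrix (Fin 2) (Fin 2) ℂ) :
    onQubit i A * onQubit i B = onQubit i (A * B) := by
  rw [onQubit, onQubit, tensorOp_mul, onQubit]
  congr 1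
  funext j
  by_cases h : j = i
  · subst h; simp
  · simp [h]

theorem onQubit_one {n : ℕ} (i : Fin n) : onQubit i 1 = 1 := by
  rw [onQubit, Function.update_eq_self_iff.2 rfl, tensorOp_one]

/-- The entries of the operator `X^p Z^q` on one qubit. -/
def weyl1 (p q r c : Fin 2) : ℤ := if r = c + p then (if q * c = 1 then -1 else 1) else 0

/-- The operator `⊗ᵢ X^{pᵢ} Z^{qᵢ}`. -/
def weyl {n : ℕ} (p q : Bits n) : Op n :=
  tensorOp fun i => Matrix.of fun r c => (weyl1 (p i) (q i) r c : ℂ)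

/-- The operators `⊗ᵢ X^{pᵢ} Z^{qᵢ}` with phases. -/
def weylSet (n : ℕ) : Set (Op n) :=
  Set.range fun t : Fin 4 × Bits n × Bits n => Complex.I ^ (t.1 : ℕ) • weyl t.2.1 t.2.2

theorem finite_weylSet (n : ℕ) : (weylSet n).Finite := Set.finite_range _

theorem smul_mem_weylSet {n : ℕ} (k : ℕ) {M : Op n} (hM : M ∈ weylSet n) :
    Complex.I ^ k • M ∈ weylSet n := by
  obtain ⟨⟨l, p, q⟩, rfl⟩ := hM
  refine ⟨(⟨(k + l) % 4, Nat.mod_lt _ (by norm_num)⟩, p, q), ?_⟩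
  have h : Complex.I ^ ((k + l) % 4) = Complex.I ^ (k + l) := by
    conv_rhs => rw [← Nat.div_add_mod (k + l) 4, pow_add, pow_mul, Complex.I_pow_four, one_pow,
      one_mul]
  simp only [smul_smul, h, pow_add]

theorem weyl_mem_weylSet {n : ℕ} (p q : Bits n) : weyl p q ∈ weylSet n :=
  ⟨(0, p, q), by simp⟩

theorem conj_mem_of_weyl {n : ℕ} {U : Op n}
    (h : ∀ p q : Bits n, ∃ (k : ℕ) (p' q' : Bits n), U * weyl p q * Uᴴ = Complex.I ^ k • weyl p' q')
    {M : Op n} (hM : M ∈ weylSet n) : U * M * Uᴴ ∈ weylSet n := by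
  obtain ⟨⟨l, p, q⟩, rfl⟩ := hM
  obtain ⟨k, p', q', hk⟩ := h p q
  simp only [Matrix.mul_smul, Matrix.smul_mul, hk]
  exact smul_mem_weylSet _ (smul_mem_weylSet _ (weyl_mem_weylSet _ _))

theorem onQubit_conj_weyl {n : ℕ} (i : Fin n) (A : Matrix (Fin 2) (Fin 2) ℂ)
    (h : ∀ p q : Fin 2, ∃ (k : ℕ) (p' q' : Fin 2),
      A * Matrix.of (fun r c => (weyl1 p q r c : ℂ)) * Aᴴ =
        Complex.I ^ k • Matrix.of (fun r c => (weyl1 p' q' r c : ℂ)))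
    (p q : Bits n) :
    ∃ (k : ℕ) (p' q' : Bits n),
      onQubit i A * weyl p q * (onQubit i A)ᴴ = Complex.I ^ k • weyl p' q' := by
  obtain ⟨k, p', q', hk⟩ := h (p i) (q i)
  refine ⟨k, Function.update p i p', Function.update q i q', ?_⟩
  rw [onQubit, weyl, tensorOp_conjTranspose, tensorOp_mul, tensorOp_mul]
  ext x y
  simp only [weyl, tensorOp, Matrix.of_apply, Matrix.smul_apply]
  rw [← Finset.mul_prod_erase Finset.univ _ (Finset.mem_univ i),
    ← Finset.mul_prod_erase Finset.univ
      (fun j => ((weyl1 (Function.update p i p' j) (Function.update q i q' j) (x j) (y j) : ℤ) : ℂ))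
      (Finset.mem_univ i)]
  simp only [Function.update_self]
  rw [hk, Matrix.smul_apply, Matrix.of_apply, smul_eq_mul, smul_eq_mul, mul_assoc]
  congr 2
  refine Finset.prod_congr rfl fun j hj => ?_
  have hj' : j ≠ i := Finset.ne_of_mem_erase hj
  simp [hj']

theorem sqrt_two_inv_mul : ((1 / Real.sqrt 2 : ℝ) : ℂ) * ((1 / Real.sqrt 2 : ℝ) : ℂ) = 1 / 2 := by
  rw [← Complex.ofReal_mul, div_mul_div_comm, Real.mul_self_sqrt (by norm_num)]
  norm_num

theorem hadamardGate_conjTranspose : hadamardGateᴴ = hadamardGate := by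
  ext r c
  fin_cases r <;> fin_cases c <;> simp [hadamardGate, Matrix.conjTranspose_apply]

theorem hadamardGate_mul_self : hadamardGate * hadamardGate = 1 := by
  rw [hadamardGate, Matrix.smul_mul, Matrix.mul_smul, smul_smul, sqrt_two_inv_mul]
  ext r c
  fin_cases r <;> fin_cases c <;> norm_num [Matrix.mul_apply, Fin.sum_univ_two]

theorem phaseGate_pow_four : phaseGate * phaseGate * (phaseGate * phaseGate) = 1 := by
  ext r c
  fin_cases r <;> fin_cases c <;>
    simp [phaseGate, Matrix.mul_apply, Fin.sum_univ_two]

theorem hadamardGate_conj (p q : Fin 2) : ∃ (k : ℕ) (p' q' : Fin 2),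
    hadamardGate * Matrix.of (fun r c => (weyl1 p q r c : ℂ)) * hadamardGateᴴ =
      Complex.I ^ k • Matrix.of (fun r c => (weyl1 p' q' r c : ℂ)) := by
  refine ⟨if p * q = 1 then 2 else 0, q, p, ?_⟩
  rw [hadamardGate_conjTranspose, hadamardGate, Matrix.smul_mul, Matrix.smul_mul, Matrix.mul_smul,
    smul_smul, sqrt_two_inv_mul]
  rw [Matrix.eta_fin_two (Matrix.of fun r c => (weyl1 p q r c : ℂ)),
    Matrix.eta_fin_two (Matrix.of fun r c => (weyl1 q p r c : ℂ))]
  have h11 : (1 : Fin 2) + 1 = 0 := rfl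
  ext r c
  fin_cases p <;> fin_cases q <;> fin_cases r <;> fin_cases c <;>
    norm_num [Matrix.mul_apply, Fin.sum_univ_two, weyl1, h11]

theorem phaseGate_conj (p q : Fin 2) : ∃ (k : ℕ) (p' q' : Fin 2),
    phaseGate * Matrix.of (fun r c => (weyl1 p q r c : ℂ)) * phaseGateᴴ =
      Complex.I ^ k • Matrix.of (fun r c => (weyl1 p' q' r c : ℂ)) := by
  refine ⟨p, p, q + p, ?_⟩
  rw [Matrix.eta_fin_two (Matrix.of fun r c => (weyl1 p q r c : ℂ)),
    Matrix.eta_fin_two (Matrix.of fun r c => (weyl1 p (q + p) r c : ℂ))]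
  have h11 : (1 : Fin 2) + 1 = 0 := rfl
  ext r c
  fin_cases p <;> fin_cases q <;> fin_cases r <;> fin_cases c <;>
    simp [Matrix.mul_apply, Fin.sum_univ_two, weyl1, phaseGate, Matrix.conjTranspose_apply, h11]

theorem cnotMap_involutive {n : ℕ} {i j : Fin n} (hij : i ≠ j) (x : Bits n) :
    cnotMap i j (cnotMap i j x) = x := by
  have key : ∀ a b : Fin 2, a + b + b = a := by decide
  funext k
  by_cases hk : k = j
  · subst hk; simp [cnotMap, hij, key]
  · simp [cnotMap, hk]

theorem cnotGate_mul {n : ℕ} {i j : Fin n} (hij : i ≠ j) (M : Op n) :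
    cnotGate i j * M = Matrix.of fun x y => M (cnotMap i j x) y := by
  ext x y
  simp only [cnotGate, Matrix.mul_apply, Matrix.of_apply, ite_mul, one_mul, zero_mul]
  rw [Finset.sum_eq_single (cnotMap i j x)]
  · simp [cnotMap_involutive hij]
  · intro z _ hz
    refine if_neg fun h => hz ?_
    rw [h, cnotMap_involutive hij]
  · simp

theorem cnotGate_conjTranspose {n : ℕ} {i j : Fin n} (hij : i ≠ j) :
    (cnotGate i j)ᴴ = cnotGate i j := by
  ext x y
  simp only [cnotGate, Matrix.conjTranspose_apply, Matrix.of_apply]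
  have : y = cnotMap i j x ↔ x = cnotMap i j y :=
    ⟨fun h => by rw [h, cnotMap_involutive hij], fun h => by rw [h, cnotMap_involutive hij]⟩
  by_cases h : x = cnotMap i j y
  · rw [if_pos h, if_pos (this.2 h), star_one]
  · rw [if_neg h, if_neg (mt this.1 h), star_zero]

theorem cnotGate_mul_self {n : ℕ} {i j : Fin n} (hij : i ≠ j) :
    cnotGate i j * cnotGate i j = 1 := by
  rw [cnotGate_mul hij]
  ext x y
  simp only [cnotGate, Matrix.of_apply, Matrix.one_apply]
  have : cnotMap i j x = cnotMap i j y ↔ x = y :=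
    ⟨fun h => by rw [← cnotMap_involutive hij x, h, cnotMap_involutive hij], fun h => by rw [h]⟩
  simp [this]

theorem weyl1_cnot : ∀ p q p' q' x y x' y' : Fin 2,
    weyl1 p q x y * weyl1 p' q' (x' + x) (y' + y) =
      weyl1 p (q + q') x y * weyl1 (p' + p) q' x' y' := by
  decide

theorem cnotGate_conj_weyl {n : ℕ} {i j : Fin n} (hij : i ≠ j) (p q : Bits n) :
    cnotGate i j * weyl p q * (cnotGate i j)ᴴ =
      weyl (Function.update p j (p j + p i)) (Function.update q i (q i + q j)) := by
  have hM : ∀ M : Op n, cnotGate i j * M * (cnotGate i j)ᴴ =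
      Matrix.of fun x y => M (cnotMap i j x) (cnotMap i j y) := by
    intro M
    have h2 : cnotGate i j * M * (cnotGate i j)ᴴ =
        (cnotGate i j * (cnotGate i j * M)ᴴ)ᴴ := by
      rw [Matrix.conjTranspose_mul, Matrix.conjTranspose_conjTranspose]
    rw [h2, cnotGate_mul hij, cnotGate_mul hij]
    ext x y
    simp [Matrix.conjTranspose_apply]
  rw [hM]
  ext x y
  simp only [weyl, tensorOp, Matrix.of_apply]
  norm_cast
  have hj : j ∈ Finset.univ.erase i := Finset.mem_erase.2 ⟨hij.symm, Finset.mem_univ j⟩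
  rw [← Finset.mul_prod_erase Finset.univ _ (Finset.mem_univ i),
    ← Finset.mul_prod_erase _ _ hj,
    ← Finset.mul_prod_erase Finset.univ
      (fun k => weyl1 (Function.update p j (p j + p i) k) (Function.update q i (q i + q j) k)
        (x k) (y k)) (Finset.mem_univ i),
    ← Finset.mul_prod_erase _ (fun k => weyl1 (Function.update p j (p j + p i) k)
      (Function.update q i (q i + q j) k) (x k) (y k)) hj, ← mul_assoc, ← mul_assoc]
  congr 1
  · simpa [cnotMap, hij, hij.symm] using weyl1_cnot (p i) (q i) (p j) (q j) (x i) (y i) (x j) (y j)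
  · refine Finset.prod_congr rfl fun k hk => ?_
    have h1 : k ≠ j := Finset.ne_of_mem_erase hk
    have h2 : k ≠ i := Finset.ne_of_mem_erase (Finset.mem_of_mem_erase hk)
    simp [cnotMap, h1, h2]

theorem generator_conj_mem {n : ℕ} {U : Op n} (hU : U ∈ cliffordGenerators n) {M : Op n}
    (hM : M ∈ weylSet n) : U * M * Uᴴ ∈ weylSet n := by
  refine conj_mem_of_weyl (fun p q => ?_) hM
  rcases hU with ⟨i, rfl⟩ | ⟨i, rfl⟩ | ⟨i, j, hij, rfl⟩
  · exact onQubit_conj_weyl i _ hadamardGate_conj p q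
  · exact onQubit_conj_weyl i _ phaseGate_conj p q
  · exact ⟨0, _, _, by rw [cnotGate_conj_weyl hij, pow_zero, one_smul]⟩

theorem generator_pow_four {n : ℕ} {U : Op n} (hU : U ∈ cliffordGenerators n) :
    U * U * (U * U) = 1 := by
  rcases hU with ⟨i, rfl⟩ | ⟨i, rfl⟩ | ⟨i, j, hij, rfl⟩
  · rw [onQubit_mul, hadamardGate_mul_self, onQubit_one, one_mul]
  · rw [onQubit_mul, onQubit_mul, phaseGate_pow_four, onQubit_one]
  · rw [cnotGate_mul_self hij, one_mul]

theorem clifford_conj_mem {n : ℕ} {U : Matrix.unitaryGroup (Bits n) ℂ} (hU : U ∈ cliffordGroup n) :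
    ∀ M ∈ weylSet n, (U : Op n) * M * (U : Op n)ᴴ ∈ weylSet n := by
  refine Subgroup.closure_induction
    (p := fun (V : Matrix.unitaryGroup (Bits n) ℂ) _ =>
      ∀ M ∈ weylSet n, (V : Op n) * M * (V : Op n)ᴴ ∈ weylSet n) ?_ ?_ ?_ ?_ hU
  · intro V hV M hM
    exact generator_conj_mem hV hM
  · intro M hM
    simpa using hM
  · intro V W _ _ hV hW M hM
    have := hV _ (hW M hM)
    simpa [Matrix.mul_assoc, Matrix.conjTranspose_mul] using this
  · intro V _ hV M hM
    have h1 : (V : Op n)ᴴ * (V : Op n) = 1 := Matrix.mem_unitaryGroup_iff'.1 V.2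
    have hcancel : ∀ N : Op n, (V : Op n)ᴴ * ((V : Op n) * N * (V : Op n)ᴴ) * (V : Op n) = N := by
      intro N
      calc _ = ((V : Op n)ᴴ * (V : Op n)) * N * ((V : Op n)ᴴ * (V : Op n)) := by
            simp only [Matrix.mul_assoc]
        _ = N := by rw [h1, one_mul, mul_one]
    have : Finite (weylSet n) := finite_weylSet n
    have hsurj : Function.Surjective
        (fun N : weylSet n => (⟨(V : Op n) * N * (V : Op n)ᴴ, hV N N.2⟩ : weylSet n)) := by
      refine Finite.surjective_of_injective fun N N' h => Subtype.ext ?_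
      have h' := congrArg Subtype.val h
      simp only at h'
      rw [← hcancel N, h', hcancel]
    obtain ⟨N, hN⟩ := hsurj ⟨M, hM⟩
    have hN' := congrArg Subtype.val hN
    simp only at hN'
    have hinv : ((V⁻¹ : Matrix.unitaryGroup (Bits n) ℂ) : Op n) = (V : Op n)ᴴ := rfl
    rw [hinv, Matrix.conjTranspose_conjTranspose, ← hN', hcancel]
    exact N.2

theorem clifford_det_pow_four {n : ℕ} {U : Matrix.unitaryGroup (Bits n) ℂ}
    (hU : U ∈ cliffordGroup n) : (U : Op n).det ^ 4 = 1 := by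
  refine Subgroup.closure_induction
    (p := fun (V : Matrix.unitaryGroup (Bits n) ℂ) _ => (V : Op n).det ^ 4 = 1) ?_ ?_ ?_ ?_ hU
  · intro V hV
    have := congrArg Matrix.det (generator_pow_four hV)
    rw [Matrix.det_mul, Matrix.det_mul, Matrix.det_one] at this
    rw [← this]; ring
  · simp
  · intro V W _ _ hV hW
    simp [Matrix.det_mul, mul_pow, hV, hW]
  · intro V _ hV
    have hinv : ((V⁻¹ : Matrix.unitaryGroup (Bits n) ℂ) : Op n) = (V : Op n)ᴴ := rfl
    rw [hinv, Matrix.det_conjTranspose, ← star_pow, hV, star_one]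

theorem scalar_of_commute_weyl {n : ℕ} {A : Op n} (h : ∀ p q : Bits n, A * weyl p q = weyl p q * A) :
    A = A 0 0 • (1 : Op n) := by
  have hX : ∀ (p x y : Bits n), weyl p 0 x y = if x = y + p then 1 else 0 := by
    intro p x y
    simp only [weyl, tensorOp, Matrix.of_apply, weyl1]
    by_cases hx : x = y + p
    · subst hx; simp
    · rw [if_neg hx]
      obtain ⟨i, hi⟩ : ∃ i, x i ≠ (y + p) i := by
        by_contra hc; push Not at hc; exact hx (funext hc)
      exact Finset.prod_eq_zero (Finset.mem_univ i) (by simpa using hi)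
  have hZ : ∀ (i : Fin n) (x y : Bits n),
      weyl 0 (Pi.single i 1) x y = if x = y then (if x i = 1 then -1 else 1) else 0 := by
    intro i x y
    simp only [weyl, tensorOp, Matrix.of_apply, weyl1]
    by_cases hx : x = y
    · subst hx
      rw [if_pos rfl, Finset.prod_eq_single i]
      · simp
      · intro j _ hj; simp [hj]
      · simp
    · rw [if_neg hx]
      obtain ⟨j, hj⟩ : ∃ j, x j ≠ y j := by
        by_contra hc; push Not at hc; exact hx (funext hc)
      exact Finset.prod_eq_zero (Finset.mem_univ j) (by simp [hj])
  ext x y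
  rw [Matrix.smul_apply, smul_eq_mul, Matrix.one_apply]
  by_cases hxy : x = y
  · subst hxy
    rw [if_pos rfl, mul_one]
    have h1 := congrFun (congrFun (h x 0) x) 0
    simp only [Matrix.mul_apply, hX] at h1
    have hself : ∀ a b : Fin 2, a = b + a ↔ b = 0 := by decide
    have e2 : ∀ z : Bits n, x = z + x ↔ z = 0 := by
      intro z; simp only [funext_iff, Pi.add_apply, Pi.zero_apply, hself]
    simpa [e2] using h1
  · rw [if_neg hxy, mul_zero]
    obtain ⟨i, hi⟩ : ∃ i, x i ≠ y i := by
      by_contra hc; push Not at hc; exact hxy (funext hc)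
    have h1 := congrFun (congrFun (h 0 (Pi.single i 1)) x) y
    simp only [Matrix.mul_apply, hZ] at h1
    simp only [mul_ite, ite_mul, mul_zero, zero_mul, Finset.sum_ite_eq, Finset.sum_ite_eq',
      Finset.mem_univ, if_true] at h1
    have hcases : ∀ a b : Fin 2, a ≠ b → (a = 1 ∧ b ≠ 1) ∨ (a ≠ 1 ∧ b = 1) := by decide
    rcases hcases _ _ hi with ⟨ha, hb⟩ | ⟨ha, hb⟩
    · simp only [ha, hb, if_true, if_false] at h1
      linear_combination (1 / 2 : ℂ) * h1
    · simp only [ha, hb, if_true, if_false] at h1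
      linear_combination (-1 / 2 : ℂ) * h1

instance finite_cliffordGroup (n : ℕ) : Finite (cliffordGroup n) := by
  have hfin : Finite (weylSet n) := finite_weylSet n
  let f : cliffordGroup n → (weylSet n → weylSet n) := fun g M =>
    ⟨cliffordUnitary g * (M : Op n) * (cliffordUnitary g)ᴴ, clifford_conj_mem g.2 M M.2⟩
  have hroots : {c : ℂ | c ^ (4 * Fintype.card (Bits n)) = 1}.Finite := by
    have hpos : 0 < 4 * Fintype.card (Bits n) := Nat.mul_pos (by norm_num) Fintype.card_pos
    refine ((Polynomial.nthRoots (4 * Fintype.card (Bits n)) (1 : ℂ)).toFinset.finite_toSet).subset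
      fun c hc => ?_
    simpa [Polynomial.mem_nthRoots hpos] using hc
  suffices h : ∀ b, (f ⁻¹' {b}).Finite by
    have hu : (⋃ b, f ⁻¹' {b}) = Set.univ := by ext g; simp
    exact Set.finite_univ_iff.1 (hu ▸ Set.finite_iUnion h)
  intro b
  rcases (f ⁻¹' {b}).eq_empty_or_nonempty with he | ⟨g₀, hg₀⟩
  · rw [he]; exact Set.finite_empty
  · refine Set.Finite.of_finite_image (f := fun g => cliffordUnitary g)
      ((hroots.image fun c => c • cliffordUnitary g₀).subset ?_)
      (fun g _ g' _ h => Subtype.ext (Subtype.ext h))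
    rintro _ ⟨g, hg, rfl⟩
    have hfg : f g = f g₀ := by
      rw [Set.mem_preimage, Set.mem_singleton_iff] at hg hg₀; rw [hg, hg₀]
    set U := cliffordUnitary g with hUdef
    set V := cliffordUnitary g₀ with hVdef
    have hU : Uᴴ * U = 1 := Matrix.mem_unitaryGroup_iff'.1 g.1.2
    have hV : Vᴴ * V = 1 := Matrix.mem_unitaryGroup_iff'.1 g₀.1.2
    have hV' : V * Vᴴ = 1 := Matrix.mem_unitaryGroup_iff.1 g₀.1.2
    have hcomm : ∀ p q : Bits n, (Vᴴ * U) * weyl p q = weyl p q * (Vᴴ * U) := by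
      intro p q
      have h1 : U * weyl p q * Uᴴ = V * weyl p q * Vᴴ :=
        congrArg Subtype.val (congrFun hfg ⟨weyl p q, weyl_mem_weylSet p q⟩)
      calc (Vᴴ * U) * weyl p q = Vᴴ * (U * weyl p q * Uᴴ) * U := by
            simp only [Matrix.mul_assoc, hU, Matrix.mul_one]
        _ = (Vᴴ * V) * weyl p q * (Vᴴ * U) := by
            rw [h1]; simp only [Matrix.mul_assoc]
        _ = weyl p q * (Vᴴ * U) := by rw [hV, one_mul]
    have hs := scalar_of_commute_weyl hcomm
    set c := (Vᴴ * U) 0 0 with hc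
    have hUc : c • V = U := by
      calc c • V = V * (c • (1 : Op n)) := by rw [Matrix.mul_smul, mul_one]
        _ = U := by rw [← hs, ← Matrix.mul_assoc, hV', one_mul]
    refine ⟨c, ?_, hUc⟩
    have hdU : U.det ^ 4 = 1 := clifford_det_pow_four g.2
    have hdV : V.det ^ 4 = 1 := clifford_det_pow_four g₀.2
    rw [← hUc, Matrix.det_smul, mul_pow, hdV, mul_one, ← pow_mul, mul_comm] at hdU
    exact hdU

noncomputable instance fintype_cliffordGroup (n : ℕ) : Fintype (cliffordGroup n) :=
  Fintype.ofFinite _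

/-! ### States, channels and norms -/

/-- A quantum state (density operator). -/
def IsState {n : ℕ} (ρ : Op n) : Prop := ρ.PosSemidef ∧ ρ.trace = 1

/-- `id_k ⊗ Λ` applied to an operator on `ℂᵏ ⊗ (ℂ²)^{⊗n}`. -/
def ampliation {n : ℕ} (k : ℕ) (Λ : SuperOp n) (M : Matrix (Fin k × Bits n) (Fin k × Bits n) ℂ) :
    Matrix (Fin k × Bits n) (Fin k × Bits n) ℂ :=
  Matrix.of fun r c => Λ (Matrix.of fun x y => M (r.1, x) (c.1, y)) r.2 c.2

/-- A quantum channel: a completely positive and trace preserving linear map. -/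
def IsQuantumChannel {n : ℕ} (Λ : SuperOp n) : Prop :=
  (∀ (k : ℕ) (M : Matrix (Fin k × Bits n) (Fin k × Bits n) ℂ),
      M.PosSemidef → (ampliation k Λ M).PosSemidef) ∧
    ∀ A : Op n, (Λ A).trace = A.trace

/-- The Hilbert-Schmidt inner product `(A|B) = Tr(A† B)`. -/
def hsInner {n : ℕ} (A B : Op n) : ℂ := (Aᴴ * B).trace

/-- The Hilbert-Schmidt norm `‖O‖₂ = √(O|O)`. -/
noncomputable def hsNorm {n : ℕ} (O : Op n) : ℝ := Real.sqrt (hsInner O O).re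

/-- The stabilizer norm `‖O‖_st = d⁻¹ ∑ₐ |(σₐ|O)|`, `d = 2ⁿ`. -/
noncomputable def stabilizerNorm {n : ℕ} (O : Op n) : ℝ :=
  (1 / (2 : ℝ) ^ n) * ∑ a : Fin n → PauliLabel, ‖hsInner (pauli a) O‖

/-- The spectral norm `‖O‖_∞`: the operator norm on the Hilbert space of the qubits. -/
noncomputable def spectralNormOp {n : ℕ} (O : Op n) : ℝ :=
  ‖Matrix.toEuclideanCLM (n := Bits n) (𝕜 := ℂ) O‖

/-- The traceless part `O₀ = O - Tr(O) 1/d`, `d = 2ⁿ`. -/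
noncomputable def tracelessPart {n : ℕ} (O : Op n) : Op n :=
  O - (O.trace / (2 : ℂ) ^ n) • (1 : Op n)

/-- The operator acting as `A` on the `k` qubits `e 0, …, e (k-1)` and as the identity on the
remaining `n - k` qubits. For `e` the inclusion of the first `k` qubits this is `A ⊗ 1^{⊗(n-k)}`. -/
noncomputable def localOp {k n : ℕ} (e : Fin k ↪ Fin n) (A : Op k) : Op n := by
  classical
  exact Matrix.of fun x y =>
    if ∀ i, i ∉ Set.range e → x i = y i then A (fun j => x (e j)) (fun j => y (e j)) else 0

/-! ### Shadow estimation

A protocol is given by a finite set `G` of labels `g`, the probabilities `p g` and the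
unitaries `u g`. -/

/-- `E_x = |x⟩⟨x|`. -/
def basisProj {n : ℕ} (x : Bits n) : Op n := Matrix.single x x 1

/-- The superoperator `|A)(B| : C ↦ (B|C) A`. -/
def hsOuter {n : ℕ} (A B : Op n) : SuperOp n where
  toFun C := hsInner B C • A
  map_add' C D := by simp [hsInner, Matrix.mul_add, add_smul]
  map_smul' c C := by simp [hsInner, smul_smul]

/-- The measure-and-prepare channel `M = ∑ₓ |E_x)(E_x|`. -/
def measureChannel (n : ℕ) : SuperOp n := ∑ x : Bits n, hsOuter (basisProj x) (basisProj x)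

/-- The superoperator `A ↦ U A U†`; for `U = g` this is `ω(g)`, and for `U = g†` it is `ω(g)†`. -/
def conjBy {n : ℕ} (U : Op n) : SuperOp n where
  toFun A := U * A * Uᴴ
  map_add' A B := by rw [Matrix.mul_add, Matrix.add_mul]
  map_smul' c A := by simp

/-- The uniform distribution. -/
noncomputable def uniformLaw (G : Type) [Fintype G] : G → ℝ := fun _ => 1 / Fintype.card G

/-- The frame operator `S = E_{g ∼ p} [ω(g)† M ω(g)]`. -/
noncomputable def frameOperator {n : ℕ} {G : Type} [Fintype G] (p : G → ℝ) (u : G → Op n) :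
    SuperOp n :=
  ∑ g, (p g : ℂ) • (conjBy (u g)ᴴ ∘ₗ measureChannel n ∘ₗ conjBy (u g))

/-- The estimator `ô(g, x) = (O| S⁻¹ ω(g)† |E_x)`. -/
noncomputable def estimator {n : ℕ} {G : Type} [Fintype G] (p : G → ℝ) (u : G → Op n) (O : Op n)
    (g : G) (x : Bits n) : ℂ :=
  hsInner O (Ring.inverse (frameOperator p u) (conjBy (u g)ᴴ (basisProj x)))

/-- The probability `(E_x| ω(g) Λ(g) |ρ)` of the outcome `x` when the noisy implementation
`ω(g) Λ(g)` of `g` is applied to `ρ` before the measurement. -/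
noncomputable def outcomeProb {n : ℕ} {G : Type} (u : G → Op n) (Λ : G → SuperOp n) (ρ : Op n)
    (g : G) (x : Bits n) : ℝ :=
  (hsInner (basisProj x) (conjBy (u g) (Λ g ρ))).re

/-- The expectation of `f(g, x)` for `g ∼ p` and `x` the outcome of the noisy measurement. -/
noncomputable def expectation {n : ℕ} {G : Type} [Fintype G] (p : G → ℝ) (u : G → Op n)
    (Λ : G → SuperOp n) (ρ : Op n) (f : G → Bits n → ℂ) : ℂ :=
  ∑ g, ∑ x, ((p g * outcomeProb u Λ ρ g x : ℝ) : ℂ) * f g x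

/-- The variance `E |ô - E ô|²` of the shadow estimator of `O` (the estimator is real for
Hermitian `O`). -/
noncomputable def shadowVariance {n : ℕ} {G : Type} [Fintype G] (p : G → ℝ) (u : G → Op n)
    (Λ : G → SuperOp n) (ρ O : Op n) : ℝ :=
  ∑ g, ∑ x, p g * outcomeProb u Λ ρ g x *
    ‖estimator p u O g x - expectation p u Λ ρ (estimator p u O)‖ ^ 2

/-! ### Pauli operators as an orthogonal basis -/

/-! Conjugation by a Clifford unitary permutes the Pauli operators up to phases, and a Pauli
operator has either no nonzero diagonal entry or only diagonal entries of modulus 1. Hence the frame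
operator is diagonal in the Pauli basis: its eigenvalue `λ_a` on `σ_a` is the probability that a
random `g` makes `σ_a` diagonal. The estimator of `∑ c_a σ_a` satisfies `|ô(g, x)| ≤ ∑ |c_a| λ_a⁻¹
z_a(g)` with `z_a(g) = diagWeight ∈ {0, 1}`.

This bound does not depend on `x`. For each fixed `g` the outcome probabilities are nonnegative and
sum to 1, whatever the channel `Λ(g)` and the state, so the noise disappears: the variance is at
most the average over `g` of the squared bound (`shadowVariance_le`). What remains is to bound
second moments of the weights `z_a` over the group.

Global group: expanding the square gives the moments `E[z_a z_b]` (`pairMoment`). Every `g` makes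
exactly `d` Pauli operators diagonal (`sum_diagWeight`), and the Clifford group can move pairs of
commuting Pauli operators to normal forms (`CliffordMoves.to_single`). Counting then gives `λ_a =
1/(d+1)` for `a ≠ 0` and `E[z_a z_b] ≤ 2/((d+1)(d+2))` for distinct nontrivial `a, b`
(`pairMoment_le`). These two numbers yield the stabilizer-norm and the Hilbert-Schmidt term.

Local group: weights and eigenvalues are products over the qubits, with factor `1/3` at each
nontrivial site. A single Pauli operator gives `λ_a⁻¹ = 3^|supp(a)|`. For `k`-local observables the
weights `λ_b⁻¹ z_b(g)` sum to `4^k` for every `g`, so Cauchy-Schwarz and Parseval reduce the claim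
to `‖A‖₂² ≤ 2^k ‖A‖_∞²`. -/

theorem pauli1_zero : pauli1 0 = 1 := rfl

theorem pauli_zero {n : ℕ} : pauli (0 : Fin n → PauliLabel) = 1 := tensorOp_one

theorem pauli1_conjTranspose (l : PauliLabel) : (pauli1 l)ᴴ = pauli1 l := by
  obtain ⟨q, p⟩ := l
  ext r c
  fin_cases q <;> fin_cases p <;> fin_cases r <;> fin_cases c <;>
    simp [pauli1, Matrix.conjTranspose_apply]

theorem pauli_conjTranspose {n : ℕ} (a : Fin n → PauliLabel) : (pauli a)ᴴ = pauli a := by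
  simp only [pauli, tensorOp_conjTranspose, pauli1_conjTranspose]

theorem sum_pauli1_mul_star (r c r' c' : Fin 2) :
    ∑ l, pauli1 l r c * star (pauli1 l r' c') = if r = r' ∧ c = c' then 2 else 0 := by
  rw [Fintype.sum_prod_type]
  fin_cases r <;> fin_cases c <;> fin_cases r' <;> fin_cases c' <;>
    simp [pauli1, Fin.sum_univ_two] <;> norm_num

/-- Completeness of the Pauli basis. The sum over labels factors over the qubits, so the
single-qubit relation suffices; the expansion of an arbitrary operator follows from this. -/
theorem sum_pauli_mul_star {n : ℕ} (x y x' y' : Bits n) :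
    ∑ a, pauli a x y * star (pauli a x' y') = if x = x' ∧ y = y' then 2 ^ n else 0 := by
  simp only [pauli, tensorOp, Matrix.of_apply, star_prod, ← Finset.prod_mul_distrib]
  rw [← Fintype.piFinset_univ, ← Finset.prod_univ_sum
    (fun _ => Finset.univ) (fun i l => pauli1 l (x i) (y i) * star (pauli1 l (x' i) (y' i)))]
  simp only [sum_pauli1_mul_star]
  by_cases h : x = x' ∧ y = y'
  · obtain ⟨rfl, rfl⟩ := h
    simp
  · rw [if_neg h]
    have : ∃ i, ¬ (x i = x' i ∧ y i = y' i) := by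
      by_contra hc
      push Not at hc
      exact h ⟨funext fun i => (hc i).1, funext fun i => (hc i).2⟩
    obtain ⟨i, hi⟩ := this
    exact Finset.prod_eq_zero (Finset.mem_univ i) (if_neg hi)

/-! ### Hilbert-Schmidt inner product, Pauli expansion and Parseval's identity. -/

theorem hsInner_eq_sum {n : ℕ} (A B : Op n) :
    hsInner A B = ∑ x, ∑ y, star (A x y) * B x y := by
  simp only [hsInner, Matrix.trace, Matrix.diag_apply, Matrix.mul_apply,
    Matrix.conjTranspose_apply]
  exact Finset.sum_comm

theorem hsInner_self {n : ℕ} (A : Op n) :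
    hsInner A A = ((∑ x, ∑ y, ‖A x y‖ ^ 2 : ℝ) : ℂ) := by
  rw [hsInner_eq_sum]
  push_cast
  refine Finset.sum_congr rfl fun x _ => Finset.sum_congr rfl fun y _ => ?_
  simpa using Complex.conj_mul' (A x y)

theorem hsNorm_sq {n : ℕ} (A : Op n) : hsNorm A ^ 2 = ∑ x, ∑ y, ‖A x y‖ ^ 2 := by
  rw [hsNorm, hsInner_self, Complex.ofReal_re, Real.sq_sqrt (by positivity)]

theorem star_hsInner {n : ℕ} (A B : Op n) : star (hsInner A B) = hsInner B A := by
  rw [hsInner, hsInner, ← Matrix.trace_conjTranspose, Matrix.conjTranspose_mul,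
    Matrix.conjTranspose_conjTranspose]

/-- The sesquilinear form `(A|B)` as a linear map in `B`. -/
def hsInnerRight {n : ℕ} (A : Op n) : Op n →ₗ[ℂ] ℂ where
  toFun B := hsInner A B
  map_add' B C := by simp [hsInner, Matrix.mul_add]
  map_smul' c B := by simp [hsInner]

theorem hsInner_smul {n : ℕ} (A B : Op n) (c : ℂ) : hsInner A (c • B) = c * hsInner A B :=
  (hsInnerRight A).map_smul c B

theorem hsInner_sum {n : ℕ} {ι : Type*} (s : Finset ι) (A : Op n) (B : ι → Op n) :
    hsInner A (∑ i ∈ s, B i) = ∑ i ∈ s, hsInner A (B i) :=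
  map_sum (hsInnerRight A) B s

theorem sum_hsInner_pauli_smul {n : ℕ} (A : Op n) :
    ∑ a, hsInner (pauli a) A • pauli a = (2 : ℂ) ^ n • A := by
  ext x y
  simp only [Matrix.sum_apply, Matrix.smul_apply, smul_eq_mul, hsInner_eq_sum, Finset.sum_mul]
  rw [Finset.sum_comm]
  have h : ∀ x' : Bits n,
      ∑ a : Fin n → PauliLabel, ∑ y', star (pauli a x' y') * A x' y' * pauli a x y =
        ∑ y', if x = x' ∧ y = y' then 2 ^ n * A x' y' else 0 := by
    intro x'
    rw [Finset.sum_comm]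
    refine Finset.sum_congr rfl fun y' _ => ?_
    rw [← ite_zero_mul, ← sum_pauli_mul_star, Finset.sum_mul]
    exact Finset.sum_congr rfl fun a _ => by ring
  simp only [h, ite_and]
  simp

theorem pauli_expansion {n : ℕ} (A : Op n) :
    A = ∑ a, (hsInner (pauli a) A / 2 ^ n) • pauli a := by
  have h := congrArg (fun B => ((2 : ℂ) ^ n)⁻¹ • B) (sum_hsInner_pauli_smul A)
  simp only [smul_smul, Finset.smul_sum] at h
  rw [inv_mul_cancel₀ (by positivity), one_smul] at h
  rw [← h]
  refine Finset.sum_congr rfl fun a _ => ?_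
  rw [h, div_eq_inv_mul]

/-- Parseval's identity for the Pauli basis. -/
theorem sum_norm_sq_hsInner_pauli {n : ℕ} (A : Op n) :
    ∑ a, ‖hsInner (pauli a) A‖ ^ 2 = 2 ^ n * hsNorm A ^ 2 := by
  have h := congrArg (hsInner A) (sum_hsInner_pauli_smul A)
  rw [hsInner_sum, hsInner_smul, hsInner_self, ← hsNorm_sq] at h
  have h2 : ∀ a, hsInner A (hsInner (pauli a) A • pauli a) =
      ((‖hsInner (pauli a) A‖ ^ 2 : ℝ) : ℂ) := by
    intro a
    rw [hsInner_smul, ← star_hsInner (pauli a) A]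
    push_cast
    exact Complex.mul_conj' _
  simp only [h2] at h
  exact_mod_cast h

theorem pauli1_mul_self (l : PauliLabel) : pauli1 l * pauli1 l = 1 := by
  obtain ⟨q, p⟩ := l
  ext r c
  fin_cases q <;> fin_cases p <;> fin_cases r <;> fin_cases c <;>
    simp [pauli1, Matrix.mul_apply, Fin.sum_univ_two]

theorem pauli_mul_self {n : ℕ} (a : Fin n → PauliLabel) : pauli a * pauli a = 1 := by
  simp only [pauli, tensorOp_mul, pauli1_mul_self, tensorOp_one]

theorem trace_pauli1_mul (l m : PauliLabel) :
    (pauli1 l * pauli1 m).trace = if l = m then 2 else 0 := by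
  obtain ⟨q, p⟩ := l
  obtain ⟨q', p'⟩ := m
  fin_cases q <;> fin_cases p <;> fin_cases q' <;> fin_cases p' <;>
    simp [pauli1, Matrix.trace, Fin.sum_univ_two] <;> norm_num

theorem trace_tensorOp {n : ℕ} (A : Fin n → Matrix (Fin 2) (Fin 2) ℂ) :
    (tensorOp A).trace = ∏ i, (A i).trace := by
  simp only [Matrix.trace, Matrix.diag_apply, tensorOp, Matrix.of_apply]
  rw [Finset.prod_univ_sum, Fintype.piFinset_univ]

theorem hsInner_pauli_pauli {n : ℕ} (a b : Fin n → PauliLabel) :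
    hsInner (pauli a) (pauli b) = if a = b then 2 ^ n else 0 := by
  rw [hsInner, pauli_conjTranspose, pauli, pauli, tensorOp_mul, trace_tensorOp]
  simp only [trace_pauli1_mul]
  by_cases h : a = b
  · subst h; simp
  · rw [if_neg h]
    obtain ⟨i, hi⟩ := Function.ne_iff.1 h
    exact Finset.prod_eq_zero (Finset.mem_univ i) (if_neg hi)

/-! ### Diagonal entries of Pauli operators -/

theorem norm_pauli1_diag (l : PauliLabel) (r : Fin 2) :
    ‖pauli1 l r r‖ = if l.2 = 0 then 1 else 0 := by
  obtain ⟨q, p⟩ := l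
  fin_cases q <;> fin_cases p <;> fin_cases r <;> simp [pauli1]

/-- The right-hand side does not involve `x`; this is what later makes the estimator bounds uniform
in the outcome. -/
theorem norm_pauli_diag {n : ℕ} (a : Fin n → PauliLabel) (x : Bits n) :
    ‖pauli a x x‖ = if ∀ i, (a i).2 = 0 then 1 else 0 := by
  simp only [pauli, tensorOp, Matrix.of_apply, norm_prod, norm_pauli1_diag,
    Finset.prod_ite_zero]
  simp

theorem pauli1_offDiag (l : PauliLabel) (hl : l.2 = 0) (r c : Fin 2) (h : r ≠ c) :
    pauli1 l r c = 0 := by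
  obtain ⟨q, p⟩ := l
  obtain rfl : p = 0 := hl
  fin_cases q <;> fin_cases r <;> fin_cases c <;> simp_all [pauli1]

theorem pauli_offDiag {n : ℕ} {a : Fin n → PauliLabel} (ha : ∀ i, (a i).2 = 0) {x y : Bits n}
    (h : x ≠ y) : pauli a x y = 0 := by
  obtain ⟨i, hi⟩ := Function.ne_iff.1 h
  refine Finset.prod_eq_zero (Finset.mem_univ i) ?_
  exact pauli1_offDiag (a i) (ha i) _ _ hi

/-! ### The measurement channel in the Pauli basis. -/

theorem hsInner_basisProj {n : ℕ} (x : Bits n) (A : Op n) : hsInner (basisProj x) A = A x x := by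
  rw [hsInner_eq_sum, Finset.sum_eq_single x, Finset.sum_eq_single x]
  · simp [basisProj]
  · intro y _ hy; simp [basisProj, hy.symm]
  · simp
  · intro y _ hy; simp [basisProj, hy.symm]
  · simp

theorem hsOuter_apply {n : ℕ} (A B C : Op n) : hsOuter A B C = hsInner B C • A := rfl

theorem conjBy_apply {n : ℕ} (U A : Op n) : conjBy U A = U * A * Uᴴ := rfl

theorem measureChannel_apply {n : ℕ} (A : Op n) :
    measureChannel n A = Matrix.diagonal fun x => A x x := by
  rw [measureChannel, LinearMap.sum_apply]
  have h : ∀ x : Bits n, hsOuter (basisProj x) (basisProj x) A = A x x • basisProj x := fun x => by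
    rw [hsOuter_apply, hsInner_basisProj]
  simp only [h]
  ext x y
  simp [Matrix.sum_apply, basisProj, Matrix.single_apply, Matrix.diagonal_apply, ite_and]

/-- The channel keeps only the diagonal, so it fixes the products of `1` and `Z` and kills all other
Pauli operators. The eigenvalue 1 or 0 is recorded as the modulus of one diagonal entry, to match
`diagWeight`. -/
theorem measureChannel_pauli {n : ℕ} (a : Fin n → PauliLabel) :
    measureChannel n (pauli a) = ((‖pauli a 0 0‖ : ℝ) : ℂ) • pauli a := by
  rw [measureChannel_apply]
  ext x y
  rw [norm_pauli_diag, Matrix.smul_apply, Matrix.diagonal_apply]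
  by_cases h : ∀ i, (a i).2 = 0
  · rw [if_pos h]
    by_cases hxy : x = y
    · subst hxy; simp
    · simp [hxy, pauli_offDiag h hxy]
  · rw [if_neg h]
    have := norm_pauli_diag a x
    rw [if_neg h, norm_eq_zero] at this
    simp [this]

/-! ### Unitaries permuting the Pauli operators up to phases -/

/-- Conjugation by `U` maps `σ_a` to a multiple of `σ_b` by a phase. -/
def PauliMoves {n : ℕ} (U : Op n) (a b : Fin n → PauliLabel) : Prop :=
  ∃ c : ℂ, ‖c‖ = 1 ∧ U * pauli a * Uᴴ = c • pauli b

/-- `1` if conjugation by `U` makes `σ_a` diagonal and `0` otherwise, for `U` permuting the Pauli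
operators up to phases. -/
noncomputable def diagWeight {n : ℕ} (U : Op n) (a : Fin n → PauliLabel) : ℝ :=
  ‖(U * pauli a * Uᴴ) 0 0‖

/-- A unitary mapping Pauli operators to Pauli operators with phases. -/
structure PermutesPaulis {n : ℕ} (U : Op n) : Prop where
  unitary : Uᴴ * U = 1
  moves : ∀ a, ∃ b, PauliMoves U a b

theorem diagWeight_nonneg {n : ℕ} (U : Op n) (a : Fin n → PauliLabel) : 0 ≤ diagWeight U a :=
  norm_nonneg _

namespace PauliMoves

variable {n : ℕ} {U V : Op n} {a b c : Fin n → PauliLabel}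

theorem norm_diag (h : PauliMoves U a b) (x : Bits n) :
    ‖(U * pauli a * Uᴴ) x x‖ = if ∀ i, (b i).2 = 0 then 1 else 0 := by
  obtain ⟨c, hc, h⟩ := h
  rw [h, Matrix.smul_apply, norm_smul, hc, one_mul, norm_pauli_diag]

theorem diagWeight_eq (h : PauliMoves U a b) :
    diagWeight U a = if ∀ i, (b i).2 = 0 then 1 else 0 := h.norm_diag 0

theorem one (a : Fin n → PauliLabel) : PauliMoves 1 a a := ⟨1, by simp, by simp⟩

theorem mul (hV : PauliMoves V b c) (hU : PauliMoves U a b) : PauliMoves (V * U) a c := by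
  obtain ⟨s, hs, hU⟩ := hU
  obtain ⟨t, ht, hV⟩ := hV
  refine ⟨s * t, by simp [hs, ht], ?_⟩
  calc V * U * pauli a * (V * U)ᴴ = V * (U * pauli a * Uᴴ) * Vᴴ := by
        simp only [Matrix.conjTranspose_mul, Matrix.mul_assoc]
    _ = (s * t) • pauli c := by
        rw [hU, Matrix.mul_smul, Matrix.smul_mul, hV, smul_smul]

theorem diagWeight_mul (hU : PauliMoves U a b) : diagWeight (V * U) a = diagWeight V b := by
  obtain ⟨s, hs, hU⟩ := hU
  have : V * U * pauli a * (V * U)ᴴ = s • (V * pauli b * Vᴴ) := by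
    calc V * U * pauli a * (V * U)ᴴ = V * (U * pauli a * Uᴴ) * Vᴴ := by
          simp only [Matrix.conjTranspose_mul, Matrix.mul_assoc]
      _ = s • (V * pauli b * Vᴴ) := by rw [hU, Matrix.mul_smul, Matrix.smul_mul]
  rw [diagWeight, this, Matrix.smul_apply, norm_smul, hs, one_mul, diagWeight]

end PauliMoves

namespace PermutesPaulis

variable {n : ℕ} {U : Op n}

theorem norm_diag (hU : PermutesPaulis U) (a : Fin n → PauliLabel) (x : Bits n) :
    ‖(U * pauli a * Uᴴ) x x‖ = diagWeight U a := by
  obtain ⟨b, hb⟩ := hU.moves a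
  rw [hb.norm_diag, hb.diagWeight_eq]

theorem diagWeight_sq (hU : PermutesPaulis U) (a : Fin n → PauliLabel) :
    diagWeight U a ^ 2 = diagWeight U a := by
  obtain ⟨b, hb⟩ := hU.moves a
  rw [hb.diagWeight_eq]
  split_ifs <;> norm_num

theorem unitary' (hU : PermutesPaulis U) : U * Uᴴ = 1 :=
  mul_eq_one_comm.1 hU.unitary

theorem diagWeight_zero (hU : PermutesPaulis U) : diagWeight U 0 = 1 := by
  simp [diagWeight, pauli_zero, hU.unitary']

theorem hsInner_pauli_conjBy (a : Fin n → PauliLabel) (U : Op n) (x : Bits n) :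
    hsInner (pauli a) (conjBy Uᴴ (basisProj x)) = star ((U * pauli a * Uᴴ) x x) := by
  rw [← hsInner_basisProj x (U * pauli a * Uᴴ), star_hsInner, hsInner, hsInner, conjBy_apply,
    Matrix.conjTranspose_conjTranspose, ← Matrix.mul_assoc, Matrix.trace_mul_comm]
  simp only [Matrix.conjTranspose_mul, Matrix.conjTranspose_conjTranspose, Matrix.mul_assoc]

/-- Parseval for the pure state `U† E_0 U`, of Hilbert-Schmidt norm 1: its Pauli coefficients have
modulus 0 or 1, so exactly `d` of them are nonzero. -/
theorem sum_diagWeight (hU : PermutesPaulis U) : ∑ a, diagWeight U a = 2 ^ n := by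
  have h := sum_norm_sq_hsInner_pauli (conjBy Uᴴ (basisProj (0 : Bits n)))
  simp only [hsInner_pauli_conjBy, norm_star, hU.norm_diag, hU.diagWeight_sq] at h
  rw [h]
  have h1 : hsInner (conjBy Uᴴ (basisProj (0 : Bits n))) (conjBy Uᴴ (basisProj (0 : Bits n))) =
      1 := by
    have hE : (basisProj (0 : Bits n))ᴴ * basisProj 0 = basisProj 0 := by simp [basisProj]
    simp only [hsInner, conjBy_apply, Matrix.conjTranspose_conjTranspose,
      Matrix.conjTranspose_mul]
    have hA : Uᴴ * ((basisProj (0 : Bits n))ᴴ * U) * (Uᴴ * basisProj 0 * U) =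
        Uᴴ * ((basisProj (0 : Bits n))ᴴ * (U * Uᴴ) * basisProj 0 * U) := by
      simp only [Matrix.mul_assoc]
    rw [hA, hU.unitary', Matrix.mul_one, hE, Matrix.trace_mul_comm, Matrix.mul_assoc, hU.unitary']
    simp [basisProj]
  rw [hsNorm, h1]
  simp

/-- Each summand of the frame operator already has the Pauli operators as eigenvectors: the phase
acquired under `U` is undone by `U†`. -/
theorem conj_measureChannel (hU : PermutesPaulis U) (a : Fin n → PauliLabel) :
    conjBy Uᴴ (measureChannel n (conjBy U (pauli a))) = ((diagWeight U a : ℝ) : ℂ) • pauli a := by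
  obtain ⟨b, hb⟩ := hU.moves a
  have hw := hb.diagWeight_eq
  rw [← norm_pauli_diag b 0] at hw
  obtain ⟨c, hc, hb⟩ := hb
  have h1 : conjBy U (pauli a) = c • pauli b := hb
  rw [h1, map_smul, measureChannel_pauli, smul_comm, ← h1, hw, map_smul]
  congr 1
  simp only [conjBy_apply, Matrix.conjTranspose_conjTranspose]
  calc _ = (Uᴴ * U) * pauli a * (Uᴴ * U) := by simp only [Matrix.mul_assoc]
    _ = pauli a := by rw [hU.unitary, one_mul, mul_one]

end PermutesPaulis

/-! ### Outcome probabilities -/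

theorem IsQuantumChannel.isState {n : ℕ} {Λ : SuperOp n} (hΛ : IsQuantumChannel Λ) {ρ : Op n}
    (hρ : IsState ρ) : IsState (Λ ρ) := by
  refine ⟨?_, by rw [hΛ.2, hρ.2]⟩
  -- Positivity is complete positivity with a one-dimensional ancilla, up to reindexing by `Fin 1 ×
  -- Bits n`.
  have h := hΛ.1 1 (ρ.submatrix Prod.snd Prod.snd) (hρ.1.submatrix _)
  exact h.submatrix fun x => ((0 : Fin 1), x)

theorem IsState.conjBy {n : ℕ} {ρ : Op n} (hρ : IsState ρ) {U : Op n} (hU : Uᴴ * U = 1) :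
    IsState (conjBy U ρ) := by
  refine ⟨hρ.1.mul_mul_conjTranspose_same U, ?_⟩
  rw [conjBy_apply, Matrix.mul_assoc, Matrix.trace_mul_comm, Matrix.mul_assoc, hU,
    Matrix.mul_one, hρ.2]

theorem outcomeProb_nonneg {n : ℕ} {G : Type} {u : G → Op n} {Λ : G → SuperOp n} {ρ : Op n}
    (hu : ∀ g, PermutesPaulis (u g)) (hΛ : ∀ g, IsQuantumChannel (Λ g))
    (hρ : IsState ρ) (g : G) (x : Bits n) : 0 ≤ outcomeProb u Λ ρ g x := by
  rw [outcomeProb, hsInner_basisProj]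
  exact (Complex.le_def.1 ((((hΛ g).isState hρ).conjBy (hu g).unitary).1.diag_nonneg (i := x))).1

theorem sum_outcomeProb {n : ℕ} {G : Type} {u : G → Op n} {Λ : G → SuperOp n} {ρ : Op n}
    (hu : ∀ g, PermutesPaulis (u g)) (hΛ : ∀ g, IsQuantumChannel (Λ g))
    (hρ : IsState ρ) (g : G) : ∑ x, outcomeProb u Λ ρ g x = 1 := by
  have h := (((hΛ g).isState hρ).conjBy (hu g).unitary).2
  simp only [outcomeProb, hsInner_basisProj]
  rw [← Complex.re_sum]
  exact (congrArg Complex.re h).trans Complex.one_re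

/-! ### The frame operator and the estimator in the Pauli basis -/

section Frame

variable {n : ℕ} {G : Type} [Fintype G] {p : G → ℝ} {u : G → Op n}

/-- The eigenvalue of the frame operator on `σ_a`. -/
noncomputable def frameEigenvalue (p : G → ℝ) (u : G → Op n) (a : Fin n → PauliLabel) : ℝ :=
  ∑ g, p g * diagWeight (u g) a

theorem frameOperator_pauli (hu : ∀ g, PermutesPaulis (u g)) (a : Fin n → PauliLabel) :
    frameOperator p u (pauli a) = ((frameEigenvalue p u a : ℝ) : ℂ) • pauli a := by
  simp only [frameOperator, LinearMap.sum_apply, LinearMap.smul_apply, LinearMap.comp_apply,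
    (hu _).conj_measureChannel, frameEigenvalue, smul_smul]
  push_cast
  rw [Finset.sum_smul]

/-- The superoperator with eigenvalues `l a` on the operators `σ_a`. -/
noncomputable def pauliDiagonal (l : (Fin n → PauliLabel) → ℂ) : SuperOp n :=
  ∑ a, (l a / 2 ^ n) • hsOuter (pauli a) (pauli a)

theorem pauliDiagonal_apply (l : (Fin n → PauliLabel) → ℂ) (A : Op n) :
    pauliDiagonal l A = ∑ a, (l a / 2 ^ n * hsInner (pauli a) A) • pauli a := by
  simp only [pauliDiagonal, LinearMap.sum_apply, LinearMap.smul_apply, hsOuter_apply, smul_smul]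

theorem hsInner_pauliDiagonal (l : (Fin n → PauliLabel) → ℂ) (a : Fin n → PauliLabel) (A : Op n) :
    hsInner (pauli a) (pauliDiagonal l A) = l a * hsInner (pauli a) A := by
  rw [pauliDiagonal_apply, hsInner_sum]
  simp only [hsInner_smul, hsInner_pauli_pauli, mul_ite, mul_zero, Finset.sum_ite_eq,
    Finset.mem_univ, if_true]
  field_simp

theorem frameOperator_mul_pauliDiagonal (hu : ∀ g, PermutesPaulis (u g))
    (hl : ∀ a, frameEigenvalue p u a ≠ 0) :
    frameOperator p u * pauliDiagonal (fun a => ((frameEigenvalue p u a : ℝ) : ℂ)⁻¹) = 1 := by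
  ext1 A
  rw [Module.End.mul_apply, pauliDiagonal_apply, map_sum, Module.End.one_apply]
  conv_rhs => rw [pauli_expansion A]
  refine Finset.sum_congr rfl fun a _ => ?_
  have : ((frameEigenvalue p u a : ℝ) : ℂ) ≠ 0 := by exact_mod_cast hl a
  rw [map_smul, frameOperator_pauli hu, smul_smul]
  congr 1
  field_simp

/-- On a finite-dimensional space a right inverse is enough. -/
theorem isUnit_frameOperator (hu : ∀ g, PermutesPaulis (u g))
    (hl : ∀ a, frameEigenvalue p u a ≠ 0) : IsUnit (frameOperator p u) :=
  IsUnit.of_mul_eq_one _ (frameOperator_mul_pauliDiagonal hu hl)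

theorem inverse_frameOperator (hu : ∀ g, PermutesPaulis (u g))
    (hl : ∀ a, frameEigenvalue p u a ≠ 0) :
    Ring.inverse (frameOperator p u) =
      pauliDiagonal (fun a => ((frameEigenvalue p u a : ℝ) : ℂ)⁻¹) := by
  rw [← one_mul (pauliDiagonal _), ← Ring.inverse_mul_cancel _ (isUnit_frameOperator hu hl),
    mul_assoc, frameOperator_mul_pauliDiagonal hu hl, mul_one]

/-- The free index type and label map `v` let one formula serve full Pauli expansions, a single
Pauli operator, and expansions of local observables. Coefficients are conjugated because the
estimator is antilinear in the observable. -/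
theorem estimator_sum_pauli (hu : ∀ g, PermutesPaulis (u g))
    (hl : ∀ a, frameEigenvalue p u a ≠ 0) {ι : Type*} (s : Finset ι) (c : ι → ℂ)
    (v : ι → Fin n → PauliLabel) (g : G) (x : Bits n) :
    estimator p u (∑ i ∈ s, c i • pauli (v i)) g x =
      ∑ i ∈ s, star (c i) * (((frameEigenvalue p u (v i) : ℝ) : ℂ)⁻¹ *
        star ((u g * pauli (v i) * (u g)ᴴ) x x)) := by
  rw [estimator, ← star_hsInner, hsInner_sum, star_sum]
  refine Finset.sum_congr rfl fun i _ => ?_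
  rw [hsInner_smul, star_mul', star_hsInner, inverse_frameOperator hu hl, hsInner_pauliDiagonal,
    PermutesPaulis.hsInner_pauli_conjBy]

theorem norm_estimator_sum_pauli_le (hu : ∀ g, PermutesPaulis (u g))
    (hl : ∀ a, 0 < frameEigenvalue p u a) {ι : Type*} (s : Finset ι) (c : ι → ℂ)
    (v : ι → Fin n → PauliLabel) (g : G) (x : Bits n) :
    ‖estimator p u (∑ i ∈ s, c i • pauli (v i)) g x‖ ≤
      ∑ i ∈ s, ‖c i‖ * ((frameEigenvalue p u (v i))⁻¹ * diagWeight (u g) (v i)) := by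
  rw [estimator_sum_pauli hu fun a => (hl a).ne']
  refine (norm_sum_le _ _).trans (Finset.sum_le_sum fun i _ => ?_)
  rw [norm_mul, norm_mul, norm_star, norm_star, (hu g).norm_diag, norm_inv, Complex.norm_real,
    Real.norm_of_nonneg (hl _).le]

theorem frameEigenvalue_zero (hu : ∀ g, PermutesPaulis (u g)) (hp : ∑ g, p g = 1) :
    frameEigenvalue p u 0 = 1 := by
  simp [frameEigenvalue, (hu _).diagWeight_zero, hp]

/-! ### Variance bounds -/

variable {Λ : G → SuperOp n} {ρ : Op n}

/-- The variance minimizes the mean square deviation from a constant. -/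
theorem sum_mul_norm_sub_mean_sq_le {ι : Type*} (s : Finset ι) (w : ι → ℝ)
    (hw : ∑ i ∈ s, w i = 1) (f : ι → ℂ) (c : ℂ) :
    ∑ i ∈ s, w i * ‖f i - ∑ j ∈ s, (w j : ℂ) * f j‖ ^ 2 ≤ ∑ i ∈ s, w i * ‖f i - c‖ ^ 2 := by
  set m := ∑ j ∈ s, (w j : ℂ) * f j with hm
  have hmean : ∑ i ∈ s, (w i : ℂ) * (f i - m) = 0 := by
    simp only [mul_sub, Finset.sum_sub_distrib, ← Finset.sum_mul, ← hm]
    rw [← Complex.ofReal_sum, hw]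
    simp
  -- The cross term vanishes because deviations from the mean average to zero.
  have hre : ∑ i ∈ s, w i * ((f i - m) * star (m - c)).re = 0 := by
    have := congrArg (fun z => (z * star (m - c)).re) hmean
    simp only [Finset.sum_mul, Complex.re_sum, zero_mul, Complex.zero_re, mul_assoc,
      Complex.re_ofReal_mul] at this
    exact this
  have hpt : ∀ i, w i * ‖f i - c‖ ^ 2 =
      w i * ‖f i - m‖ ^ 2 + 2 * (w i * ((f i - m) * star (m - c)).re) + w i * ‖m - c‖ ^ 2 := by
    intro i
    rw [show f i - c = (f i - m) + (m - c) by ring, ← Complex.normSq_eq_norm_sq,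
      Complex.normSq_add, Complex.normSq_eq_norm_sq, Complex.normSq_eq_norm_sq]
    simp only [starRingEnd_apply]
    ring
  simp only [hpt, Finset.sum_add_distrib, ← Finset.mul_sum, hre, ← Finset.sum_mul, hw]
  nlinarith [sq_nonneg ‖m - c‖]

/-- Since `B` depends on `g` alone, summing over `x` only uses that the outcome probabilities are
nonnegative with total 1; noise and state drop out. The centre `c` may be any constant. -/
theorem shadowVariance_le (hp : ∀ g, 0 ≤ p g) (hp1 : ∑ g, p g = 1)
    (hu : ∀ g, PermutesPaulis (u g)) (hΛ : ∀ g, IsQuantumChannel (Λ g)) (hρ : IsState ρ)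
    (O : Op n) (c : ℂ) (B : G → ℝ) (hB : ∀ g x, ‖estimator p u O g x - c‖ ≤ B g) :
    shadowVariance p u Λ ρ O ≤ ∑ g, p g * B g ^ 2 := by
  have hprob := outcomeProb_nonneg hu hΛ hρ
  have hsum := sum_outcomeProb hu hΛ hρ
  have hw : ∑ i : G × Bits n, p i.1 * outcomeProb u Λ ρ i.1 i.2 = 1 := by
    rw [Fintype.sum_prod_type]
    simp only [← Finset.mul_sum, hsum, mul_one, hp1]
  have h := sum_mul_norm_sub_mean_sq_le Finset.univ
    (fun i : G × Bits n => p i.1 * outcomeProb u Λ ρ i.1 i.2) hw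
    (fun i => estimator p u O i.1 i.2) c
  simp only [Fintype.sum_prod_type] at h
  refine (le_of_eq ?_).trans (h.trans ?_)
  · rfl
  · refine Finset.sum_le_sum fun g _ => ?_
    calc _ ≤ ∑ x, p g * outcomeProb u Λ ρ g x * B g ^ 2 := by
          refine Finset.sum_le_sum fun x _ => ?_
          refine mul_le_mul_of_nonneg_left ?_ (mul_nonneg (hp g) (hprob g x))
          exact pow_le_pow_left₀ (norm_nonneg _) (hB g x) 2
      _ = p g * B g ^ 2 := by
          rw [← Finset.sum_mul, ← Finset.mul_sum, hsum, mul_one]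

end Frame

/-! ### Clifford unitaries permute the Pauli operators -/

theorem tensorOp_smul {n : ℕ} (c : Fin n → ℂ) (A : Fin n → Matrix (Fin 2) (Fin 2) ℂ) :
    tensorOp (fun i => c i • A i) = (∏ i, c i) • tensorOp A := by
  ext x y
  simp [tensorOp, Finset.prod_mul_distrib]

theorem PauliMoves.tensorOp {n : ℕ} {A : Fin n → Matrix (Fin 2) (Fin 2) ℂ}
    {a b : Fin n → PauliLabel}
    (h : ∀ i, ∃ c : ℂ, ‖c‖ = 1 ∧ A i * pauli1 (a i) * (A i)ᴴ = c • pauli1 (b i)) :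
    PauliMoves (tensorOp A) a b := by
  choose c hc h using h
  refine ⟨∏ i, c i, by simp [hc], ?_⟩
  rw [tensorOp_conjTranspose, pauli, tensorOp_mul, tensorOp_mul, pauli, ← tensorOp_smul]
  simp only [h]

theorem PauliMoves.onQubit {n : ℕ} {A : Matrix (Fin 2) (Fin 2) ℂ} {i : Fin n}
    (a : Fin n → PauliLabel) {l : PauliLabel} {c : ℂ} (hc : ‖c‖ = 1)
    (h : A * pauli1 (a i) * Aᴴ = c • pauli1 l) :
    PauliMoves (onQubit i A) a (Function.update a i l) := by
  refine PauliMoves.tensorOp fun j => ?_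
  by_cases hj : j = i
  · subst hj
    exact ⟨c, hc, by simpa using h⟩
  · exact ⟨1, by simp, by simp [hj]⟩

theorem hadamardGate_conj_pauli1 (l : PauliLabel) :
    ∃ c : ℂ, ‖c‖ = 1 ∧ hadamardGate * pauli1 l * hadamardGateᴴ = c • pauli1 (l.2, l.1) := by
  -- Hadamard exchanges `X` and `Z` and sends `Y` to `-Y`.
  refine ⟨if l = (1, 1) then -1 else 1, by split_ifs <;> simp, ?_⟩
  rw [hadamardGate_conjTranspose, hadamardGate, Matrix.smul_mul, Matrix.smul_mul, Matrix.mul_smul,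
    smul_smul, sqrt_two_inv_mul]
  obtain ⟨q, p⟩ := l
  ext r c
  fin_cases q <;> fin_cases p <;> fin_cases r <;> fin_cases c <;>
    norm_num [pauli1, Matrix.mul_apply, Fin.sum_univ_two] <;> ring

theorem phaseGate_conj_pauli1 (l : PauliLabel) :
    ∃ c : ℂ, ‖c‖ = 1 ∧ phaseGate * pauli1 l * phaseGateᴴ = c • pauli1 (l.1 + l.2, l.2) := by
  -- The phase gate fixes `Z`, sends `X` to `Y` and `Y` to `-X`.
  refine ⟨if l = (1, 1) then -1 else 1, by split_ifs <;> simp, ?_⟩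
  have h11 : (1 : Fin 2) + 1 = 0 := rfl
  obtain ⟨q, p⟩ := l
  ext r c
  fin_cases q <;> fin_cases p <;> fin_cases r <;> fin_cases c <;>
    simp [pauli1, Matrix.mul_apply, Fin.sum_univ_two, phaseGate, Matrix.conjTranspose_apply, h11]

theorem pauli1_eq_smul_weyl1 (l : PauliLabel) :
    ∃ c : ℂ, ‖c‖ = 1 ∧ pauli1 l = c • Matrix.of fun r s => (weyl1 l.2 l.1 r s : ℂ) := by
  refine ⟨if l = (1, 1) then Complex.I else 1, by split_ifs <;> simp, ?_⟩
  have h11 : (1 : Fin 2) + 1 = 0 := rfl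
  obtain ⟨q, p⟩ := l
  ext r c
  fin_cases q <;> fin_cases p <;> fin_cases r <;> fin_cases c <;>
    simp [pauli1, weyl1, h11]

theorem pauli_eq_smul_weyl {n : ℕ} (a : Fin n → PauliLabel) :
    ∃ c : ℂ, ‖c‖ = 1 ∧ pauli a = c • weyl (fun i => (a i).2) (fun i => (a i).1) := by
  choose c hc h using pauli1_eq_smul_weyl1
  refine ⟨∏ i, c (a i), by simp [hc], ?_⟩
  rw [weyl, ← tensorOp_smul, pauli]
  congr 1
  funext i
  exact h (a i)

/-- `σ_a` and the corresponding Weyl operator differ by a phase, so the conjugation rules proved for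
Weyl operators carry over. -/
theorem PauliMoves.of_weyl {n : ℕ} {U : Op n} {a b : Fin n → PauliLabel} {c : ℂ} (hc : ‖c‖ = 1)
    (h : U * weyl (fun i => (a i).2) (fun i => (a i).1) * Uᴴ =
      c • weyl (fun i => (b i).2) (fun i => (b i).1)) : PauliMoves U a b := by
  obtain ⟨s, hs, ha⟩ := pauli_eq_smul_weyl a
  obtain ⟨t, ht, hb⟩ := pauli_eq_smul_weyl b
  have ht0 : t ≠ 0 := fun h0 => by simp [h0] at ht
  refine ⟨s * c * t⁻¹, by simp [hs, hc, ht], ?_⟩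
  rw [ha, Matrix.mul_smul, Matrix.smul_mul, h, hb, smul_smul, smul_smul,
    inv_mul_cancel_right₀ ht0]

theorem permutesPaulis_cliffordUnitary {n : ℕ} (g : cliffordGroup n) :
    PermutesPaulis (cliffordUnitary g) := by
  refine ⟨Matrix.mem_unitaryGroup_iff'.1 g.1.2, fun a => ?_⟩
  obtain ⟨⟨k, p, q⟩, h⟩ :=
    clifford_conj_mem g.2 _ (weyl_mem_weylSet (fun i => (a i).2) (fun i => (a i).1))
  exact ⟨fun i => (q i, p i), PauliMoves.of_weyl (c := Complex.I ^ (k : ℕ)) (by simp) h.symm⟩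

/-! ### Transitivity of the Clifford group on pairs of commuting Pauli operators -/

theorem cliffordUnitary_mul {n : ℕ} (g h : cliffordGroup n) :
    cliffordUnitary (g * h) = cliffordUnitary g * cliffordUnitary h := rfl

theorem exists_cliffordUnitary_eq {n : ℕ} {U : Op n} (hU : U ∈ cliffordGenerators n) :
    ∃ g : cliffordGroup n, cliffordUnitary g = U := by
  have h4 := generator_pow_four hU
  have hconj : U * Uᴴ = 1 := by
    rcases hU with ⟨i, rfl⟩ | ⟨i, rfl⟩ | ⟨i, j, hij, rfl⟩
    · have : (onQubit i hadamardGate)ᴴ = onQubit i hadamardGateᴴ := by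
        rw [onQubit, tensorOp_conjTranspose, onQubit]
        congr 1
        funext j
        by_cases hj : j = i
        · subst hj; simp
        · simp [hj]
      rw [this, onQubit_mul, hadamardGate_conjTranspose, hadamardGate_mul_self, onQubit_one]
    · have : (onQubit i phaseGate)ᴴ = onQubit i phaseGateᴴ := by
        rw [onQubit, tensorOp_conjTranspose, onQubit]
        congr 1
        funext j
        by_cases hj : j = i
        · subst hj; simp
        · simp [hj]
      have hS : phaseGate * phaseGateᴴ = 1 := by
        ext r c
        fin_cases r <;> fin_cases c <;>
          simp [phaseGate, Matrix.mul_apply, Fin.sum_univ_two, Matrix.conjTranspose_apply]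
      rw [this, onQubit_mul, hS, onQubit_one]
    · rw [cnotGate_conjTranspose hij, cnotGate_mul_self hij]
  exact ⟨⟨⟨U, Matrix.mem_unitaryGroup_iff.2 hconj⟩, Subgroup.subset_closure hU⟩, rfl⟩

/-- Some Clifford unitary moves `σ_v` to `σ_v'` and `σ_w` to `σ_w'`, up to phases. -/
def CliffordMoves {n : ℕ} (v w v' w' : Fin n → PauliLabel) : Prop :=
  ∃ g : cliffordGroup n, PauliMoves (cliffordUnitary g) v v' ∧ PauliMoves (cliffordUnitary g) w w'

namespace CliffordMoves

variable {n : ℕ} {v w v' w' v'' w'' : Fin n → PauliLabel}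

theorem refl (v w : Fin n → PauliLabel) : CliffordMoves v w v w :=
  ⟨1, PauliMoves.one v, PauliMoves.one w⟩

theorem trans (h : CliffordMoves v w v' w') (h' : CliffordMoves v' w' v'' w'') :
    CliffordMoves v w v'' w'' := by
  obtain ⟨g, hv, hw⟩ := h
  obtain ⟨g', hv', hw'⟩ := h'
  exact ⟨g' * g, hv'.mul hv, hw'.mul hw⟩

theorem of_generator {U : Op n} (hU : U ∈ cliffordGenerators n) (hv : PauliMoves U v v')
    (hw : PauliMoves U w w') : CliffordMoves v w v' w' := by
  obtain ⟨g, rfl⟩ := exists_cliffordUnitary_eq hU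
  exact ⟨g, hv, hw⟩

theorem hadamard (i : Fin n) (hv : v i = 0) :
    CliffordMoves v w v (Function.update w i ((w i).2, (w i).1)) := by
  have key : ∀ a : Fin n → PauliLabel, PauliMoves (onQubit i hadamardGate) a
      (Function.update a i ((a i).2, (a i).1)) := fun a => by
    obtain ⟨c, hc, h⟩ := hadamardGate_conj_pauli1 (a i)
    exact PauliMoves.onQubit a hc h
  refine of_generator (Or.inl ⟨i, rfl⟩) ?_ (key w)
  have hself : Function.update v i ((v i).2, (v i).1) = v := by
    rw [hv]; exact Function.update_eq_self_iff.2 hv.symm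
  simpa only [hself] using key v

theorem phase (i : Fin n) (hv : v i = 0) :
    CliffordMoves v w v (Function.update w i ((w i).1 + (w i).2, (w i).2)) := by
  have key : ∀ a : Fin n → PauliLabel, PauliMoves (onQubit i phaseGate) a
      (Function.update a i ((a i).1 + (a i).2, (a i).2)) := fun a => by
    obtain ⟨c, hc, h⟩ := phaseGate_conj_pauli1 (a i)
    exact PauliMoves.onQubit a hc h
  refine of_generator (Or.inr (Or.inl ⟨i, rfl⟩)) ?_ (key w)
  have hself : Function.update v i ((v i).1 + (v i).2, (v i).2) = v := by
    rw [hv]; exact Function.update_eq_self_iff.2 hv.symm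
  simpa only [hself] using key v

/-- Conjugation by the gate with control `i` and target `j` adds the `Z` exponent of the target to
that of the control. As `v` is trivial on the target, it is left unchanged. -/
theorem cnot {i j : Fin n} (hij : i ≠ j) (hv : ∀ k, (v k).2 = 0) (hvj : v j = 0)
    (hw : ∀ k, (w k).2 = 0) :
    CliffordMoves v w v (Function.update w i ((w i).1 + (w j).1, 0)) := by
  have key : ∀ a : Fin n → PauliLabel, (∀ k, (a k).2 = 0) → PauliMoves (cnotGate i j) a
      (Function.update a i ((a i).1 + (a j).1, 0)) := fun a ha => by
    refine PauliMoves.of_weyl (c := 1) (by simp) ?_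
    rw [cnotGate_conj_weyl hij, one_smul]
    congr 1
    · funext k
      by_cases hk : k = i
      · subst hk; simp [hij, ha]
      · by_cases hkj : k = j
        · subst hkj; simp [hk, ha]
        · simp [hk, hkj]
    · funext k
      by_cases hk : k = i
      · subst hk; simp
      · simp [hk]
  refine of_generator (Or.inr (Or.inr ⟨i, j, hij, rfl⟩)) ?_ (key w hw)
  have hself : Function.update v i ((v i).1 + (v j).1, 0) = v := by
    rw [Function.update_eq_self_iff, hvj]
    exact Prod.ext (add_zero _) (hv i).symm
  simpa only [hself] using key v hv

/-- Hadamard turns `X` into `Z`; for `Y`, the phase gate first gives `X` up to sign. Gates on a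
qubit where `v` is trivial do not affect `v`. -/
theorem exists_xFree_at (i : Fin n) (hv : v i = 0) (w : Fin n → PauliLabel) :
    ∃ l : PauliLabel, CliffordMoves v w v (Function.update w i l) ∧ l.2 = 0 ∧
      (l = 0 ↔ w i = 0) := by
  have h11 : (1 : Fin 2) + 1 = 0 := rfl
  have hcases : ∀ l : PauliLabel, l.2 = 0 ∨ l = (0, 1) ∨ l = (1, 1) := by decide
  rcases hcases (w i) with h | h | h
  · exact ⟨w i, by simpa using refl v w, h, Iff.rfl⟩
  · refine ⟨(1, 0), ?_, rfl, by simp [h]⟩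
    simpa [h] using hadamard (w := w) i hv
  · refine ⟨(1, 0), ?_, rfl, by simp [h]⟩
    have h1 := phase (w := w) i hv
    have h2 := h1.trans (hadamard i hv)
    simpa [h, h11] using h2

theorem exists_xFree (s : Finset (Fin n)) (hv : ∀ i ∈ s, v i = 0) (w : Fin n → PauliLabel) :
    ∃ w', CliffordMoves v w v w' ∧ (∀ i ∈ s, (w' i).2 = 0) ∧ (∀ i ∉ s, w' i = w i) ∧
      ∀ i, w' i = 0 ↔ w i = 0 := by
  induction s using Finset.induction_on with
  | empty => exact ⟨w, refl v w, by simp, fun _ _ => rfl, fun _ => Iff.rfl⟩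
  | insert i s his ih =>
    obtain ⟨w', h, h1, h2, h3⟩ := ih fun j hj => hv j (Finset.mem_insert_of_mem hj)
    obtain ⟨l, hl, hl2, hl0⟩ := exists_xFree_at i (hv i (Finset.mem_insert_self i s)) w'
    refine ⟨Function.update w' i l, h.trans hl, ?_, ?_, ?_⟩
    · intro j hj
      by_cases hji : j = i
      · subst hji; simpa using hl2
      · simpa [hji] using h1 j ((Finset.mem_insert.1 hj).resolve_left hji)
    · intro j hj
      rw [Finset.mem_insert, not_or] at hj
      simpa [hj.1] using h2 j hj.2
    · intro j
      by_cases hji : j = i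
      · subst hji; simpa using hl0.trans (h3 j)
      · simpa [hji] using h3 j

/-- The `Z` on qubit `j` is a pivot: a controlled-NOT with target `j` cancels a `Z` on its control
qubit, so the qubits of `s` are cleared one at a time. -/
theorem clear (hv : ∀ k, (v k).2 = 0) {j : Fin n} (hvj : v j = 0) (hw : ∀ k, (w k).2 = 0)
    (hwj : w j = (1, 0)) (s : Finset (Fin n)) (hj : j ∉ s) :
    CliffordMoves v w v (fun i => if i ∈ s then 0 else w i) := by
  induction s using Finset.induction_on with
  | empty => simpa using refl v w
  | insert i s his ih =>
    rw [Finset.mem_insert, not_or] at hj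
    refine (ih hj.2).trans ?_
    set w' : Fin n → PauliLabel := fun i => if i ∈ s then 0 else w i with hw'
    have hgoal : (fun k => if k ∈ insert i s then 0 else w k) = Function.update w' i 0 := by
      funext k
      by_cases hk : k = i
      · subst hk; simp
      · simp [hk, hw']
    rw [hgoal]
    have hcases : ∀ q : Fin 2, q = 0 ∨ q = 1 := by decide
    rcases hcases (w i).1 with h | h
    · have : w' i = 0 := by simp [hw', his]; exact Prod.ext h (hw i)
      rw [← this, Function.update_eq_self]
      exact refl _ _
    · have hx : ∀ k, (w' k).2 = 0 := fun k => by
        by_cases hk : k ∈ s <;> simp [hw', hk, hw]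
      have h1 := cnot (w := w') (fun h => hj.1 h.symm : i ≠ j) hv hvj hx
      have h11 : (1 : Fin 2) + 1 = 0 := rfl
      have h2 : ((w' i).1 + (w' j).1, (0 : Fin 2)) = 0 := by
        simp [hw', his, hj.2, h, hwj, h11]
      rwa [h2] at h1

/-- A Pauli operator that is not the identity on qubit `j` can be moved to `Z` on qubit `j`,
fixing a given tensor product of `Z`s and identities. -/
theorem to_single (hv : ∀ k, (v k).2 = 0) (hw : ∀ k, v k ≠ 0 → (w k).2 = 0) {j : Fin n}
    (hvj : v j = 0) (hwj : w j ≠ 0) : CliffordMoves v w v (Pi.single j (1, 0)) := by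
  classical
  obtain ⟨w', h, h1, h2, h3⟩ :=
    exists_xFree (v := v) (Finset.univ.filter fun k => v k = 0) (by simp) w
  have hx : ∀ k, (w' k).2 = 0 := fun k => by
    by_cases hk : v k = 0
    · exact h1 k (by simpa using hk)
    · rw [h2 k (by simpa using hk)]; exact hw k hk
  have hj : w' j = (1, 0) := by
    have : ∀ l : PauliLabel, l ≠ 0 → l.2 = 0 → l = (1, 0) := by decide
    exact this _ (mt (h3 j).1 hwj) (hx j)
  have h4 := h.trans (clear hv hvj hx hj (Finset.univ.erase j) (by simp))
  convert h4 using 1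
  funext k
  by_cases hk : k = j
  · subst hk; simp [hj]
  · simp [hk]

end CliffordMoves

/-! ### Moments of the diagonal weights over the Clifford group -/

/-- Conjugation is injective, and distinct Pauli operators are orthogonal, hence not proportional.
-/
theorem PauliMoves.eq_of_same_target {n : ℕ} {U : Op n} (hU : Uᴴ * U = 1)
    {a b c : Fin n → PauliLabel} (ha : PauliMoves U a c) (hb : PauliMoves U b c) : a = b := by
  obtain ⟨s, hs, ha⟩ := ha
  obtain ⟨t, ht, hb⟩ := hb
  have hcancel : ∀ A : Op n, Uᴴ * (U * A * Uᴴ) * U = A := fun A => by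
    calc Uᴴ * (U * A * Uᴴ) * U = (Uᴴ * U) * A * (Uᴴ * U) := by simp only [Matrix.mul_assoc]
      _ = A := by rw [hU, one_mul, mul_one]
  have h : t • pauli a = s • pauli b := by
    rw [← hcancel (pauli a), ← hcancel (pauli b), ha, hb]
    simp only [Matrix.mul_smul, Matrix.smul_mul]
    rw [smul_comm]
  have h2 := congrArg (hsInner (pauli a)) h
  by_contra hab
  rw [hsInner_smul, hsInner_smul, hsInner_pauli_pauli, hsInner_pauli_pauli, if_pos rfl, if_neg hab,
    mul_zero] at h2
  have ht0 : t ≠ 0 := fun h0 => by simp [h0] at ht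
  exact mul_ne_zero ht0 (by positivity) h2

theorem PermutesPaulis.moves_zero {n : ℕ} {U : Op n} (hU : PermutesPaulis U) :
    PauliMoves U 0 0 := ⟨1, by simp, by simp [pauli_zero, hU.unitary']⟩

/-! ### Commutation as an obstruction to simultaneous diagonalization. -/

theorem pauli_mul_comm_of_xFree {n : ℕ} {a b : Fin n → PauliLabel} (ha : ∀ i, (a i).2 = 0)
    (hb : ∀ i, (b i).2 = 0) : pauli a * pauli b = pauli b * pauli a := by
  have key : ∀ l m : PauliLabel, l.2 = 0 → m.2 = 0 → pauli1 l * pauli1 m = pauli1 m * pauli1 l := by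
    rintro ⟨q, p⟩ ⟨q', p'⟩ hl hm
    obtain rfl : p = 0 := hl
    obtain rfl : p' = 0 := hm
    ext r c
    fin_cases q <;> fin_cases q' <;> fin_cases r <;> fin_cases c <;>
      simp [pauli1, Matrix.mul_apply, Fin.sum_univ_two]
  simp only [pauli, tensorOp_mul, key _ _ (ha _) (hb _)]

theorem pauli_single_mul_anticomm {n : ℕ} (i : Fin n) (w : Fin n → PauliLabel) (hw : (w i).2 = 1) :
    pauli (Pi.single i (1, 0)) * pauli w = -(pauli w * pauli (Pi.single i (1, 0))) := by
  have key : ∀ l : PauliLabel, l.2 = 1 →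
      pauli1 (1, 0) * pauli1 l = (-1 : ℂ) • (pauli1 l * pauli1 (1, 0)) := by
    rintro ⟨q, p⟩ hl
    obtain rfl : p = 1 := hl
    ext r c
    fin_cases q <;> fin_cases r <;> fin_cases c <;>
      simp [pauli1, Matrix.mul_apply, Fin.sum_univ_two]
  have hprod : (∏ k : Fin n, if k = i then (-1 : ℂ) else 1) = -1 := by simp
  rw [pauli, pauli, tensorOp_mul, tensorOp_mul, ← neg_one_smul ℂ, ← hprod, ← tensorOp_smul]
  congr 1
  funext k
  by_cases hk : k = i
  · subst hk; simpa using key _ hw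
  · simp [hk, pauli1_zero]

/-- Operators that become diagonal under the same unitary commute, whereas `Z` on qubit `i`
anticommutes with any `σ_w` carrying `X` or `Y` there. -/
theorem PermutesPaulis.diagWeight_mul_eq_zero {n : ℕ} {U : Op n} (hU : PermutesPaulis U)
    (i : Fin n) (w : Fin n → PauliLabel) (hw : (w i).2 = 1) :
    diagWeight U (Pi.single i (1, 0)) * diagWeight U w = 0 := by
  set z : Fin n → PauliLabel := Pi.single i (1, 0) with hz
  obtain ⟨a, ha⟩ := hU.moves z
  obtain ⟨b, hb⟩ := hU.moves w
  by_contra hne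
  rw [ha.diagWeight_eq, hb.diagWeight_eq] at hne
  have hax : ∀ i, (a i).2 = 0 := by
    by_contra h; simp [h] at hne
  have hbx : ∀ i, (b i).2 = 0 := by
    by_contra h; simp [h] at hne
  obtain ⟨s, hs, ha⟩ := ha
  obtain ⟨t, ht, hb⟩ := hb
  have hmul : ∀ A B : Op n, A * B = Uᴴ * ((U * A * Uᴴ) * (U * B * Uᴴ)) * U := fun A B => by
    calc A * B = (Uᴴ * U) * A * (Uᴴ * U) * B * (Uᴴ * U) := by
          rw [hU.unitary, one_mul, mul_one, mul_one]
      _ = _ := by simp only [Matrix.mul_assoc]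
  have hcomm : pauli z * pauli w = pauli w * pauli z := by
    rw [hmul, hmul (pauli w), ha, hb]
    simp only [Matrix.smul_mul, Matrix.mul_smul]
    rw [pauli_mul_comm_of_xFree hax hbx, smul_comm]
  -- Commuting and anticommuting together force the product to vanish, which is impossible for a
  -- product of involutions.
  have h0 : pauli w * pauli z = 0 := by
    ext x y
    exact self_eq_neg.1 ((congrFun (congrFun hcomm.symm x) y).trans (congrFun (congrFun
      (pauli_single_mul_anticomm i w hw) x) y))
  have h1 : pauli w * (pauli w * pauli z) * pauli z = 1 := by
    rw [← Matrix.mul_assoc, pauli_mul_self, one_mul, pauli_mul_self]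
  rw [h0] at h1
  simp at h1

theorem sum_uniformLaw (G : Type) [Fintype G] [Nonempty G] : ∑ g, uniformLaw G g = 1 := by
  simp [uniformLaw]

theorem uniformLaw_nonneg (G : Type) [Fintype G] (g : G) : 0 ≤ uniformLaw G g := by
  unfold uniformLaw; positivity

/-- The second moment of the diagonal weights of `σ_v` and `σ_w`. -/
noncomputable def pairMoment {n : ℕ} (v w : Fin n → PauliLabel) : ℝ :=
  ∑ g : cliffordGroup n, uniformLaw (cliffordGroup n) g *
    (diagWeight (cliffordUnitary g) v * diagWeight (cliffordUnitary g) w)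

/-- The first moment of the diagonal weight of `σ_v`. -/
noncomputable abbrev cliffordEigenvalue {n : ℕ} (v : Fin n → PauliLabel) : ℝ :=
  frameEigenvalue (uniformLaw (cliffordGroup n)) cliffordUnitary v

section Moments

variable {n : ℕ} {v w v' w' : Fin n → PauliLabel}

/-- The uniform distribution is invariant under right translation by the moving element. -/
theorem CliffordMoves.pairMoment_eq (h : CliffordMoves v w v' w') :
    pairMoment v w = pairMoment v' w' := by
  obtain ⟨g, hv, hw⟩ := h
  rw [pairMoment, ← Equiv.sum_comp (Equiv.mulRight g)]
  refine Finset.sum_congr rfl fun k _ => ?_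
  rw [Equiv.coe_mulRight, cliffordUnitary_mul, hv.diagWeight_mul, hw.diagWeight_mul]
  rfl

theorem pairMoment_zero_left (w : Fin n → PauliLabel) :
    pairMoment 0 w = cliffordEigenvalue w := by
  simp [pairMoment, frameEigenvalue, (permutesPaulis_cliffordUnitary _).diagWeight_zero]

theorem pairMoment_zero_right (v : Fin n → PauliLabel) :
    pairMoment v 0 = cliffordEigenvalue v := by
  simp [pairMoment, frameEigenvalue, (permutesPaulis_cliffordUnitary _).diagWeight_zero]

theorem pairMoment_self (v : Fin n → PauliLabel) :
    pairMoment v v = cliffordEigenvalue v := by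
  simp [pairMoment, frameEigenvalue, ← pow_two, (permutesPaulis_cliffordUnitary _).diagWeight_sq]

/-- Every `g` diagonalizes exactly `d` Pauli operators. This identity turns symmetry of the moments
into their values. -/
theorem sum_pairMoment (v : Fin n → PauliLabel) :
    ∑ w, pairMoment v w = 2 ^ n * cliffordEigenvalue v := by
  simp only [pairMoment]
  rw [Finset.sum_comm]
  simp only [← Finset.mul_sum, (permutesPaulis_cliffordUnitary _).sum_diagWeight, frameEigenvalue]
  rw [Finset.mul_sum]
  exact Finset.sum_congr rfl fun g _ => by ring

/-- The operator `Z_i Z_j` can be reduced to `Z_i` as well as to `Z_j`, in both cases fixing `σ_v`.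
-/
theorem pairMoment_single (hv : ∀ k, (v k).2 = 0) {i j : Fin n} (hi : v i = 0) (hj : v j = 0) :
    pairMoment v (Pi.single i (1, 0)) = pairMoment v (Pi.single j (1, 0)) := by
  by_cases hij : i = j
  · rw [hij]
  set w : Fin n → PauliLabel := Function.update (Pi.single i (1, 0)) j (1, 0) with hw
  have hwx : ∀ k, v k ≠ 0 → (w k).2 = 0 := fun k hk => by
    have h1 : k ≠ i := fun h => hk (h ▸ hi)
    have h2 : k ≠ j := fun h => hk (h ▸ hj)
    simp [hw, h1, h2]
  have hwi : w i ≠ 0 := by simp [hw, hij]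
  have hwj : w j ≠ 0 := by simp [hw]
  rw [← (CliffordMoves.to_single hv hwx hi hwi).pairMoment_eq,
    (CliffordMoves.to_single hv hwx hj hwj).pairMoment_eq]

theorem cliffordEigenvalue_eq_of_ne_zero (hv : v ≠ 0) (hw : w ≠ 0) :
    cliffordEigenvalue v = cliffordEigenvalue w := by
  obtain ⟨i, hi⟩ := Function.ne_iff.1 hv
  obtain ⟨j, hj⟩ := Function.ne_iff.1 hw
  rw [← pairMoment_zero_left, ← pairMoment_zero_left,
    (CliffordMoves.to_single (v := 0) (by simp) (by simp) rfl hi).pairMoment_eq,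
    (CliffordMoves.to_single (v := 0) (by simp) (by simp) rfl hj).pairMoment_eq]
  exact pairMoment_single (by simp) rfl rfl

theorem cliffordEigenvalue_zero : cliffordEigenvalue (0 : Fin n → PauliLabel) = 1 :=
  frameEigenvalue_zero permutesPaulis_cliffordUnitary (sum_uniformLaw _)

theorem card_pauliLabels (n : ℕ) : (Fintype.card (Fin n → PauliLabel) : ℝ) = 2 ^ n * 2 ^ n := by
  rw [Fintype.card_fun, Fintype.card_prod, Fintype.card_fin, Fintype.card_fin, ← mul_pow]
  norm_num

/-- The nontrivial eigenvalue `1 / (d + 1)` of the frame operator of the Clifford group. -/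
theorem cliffordEigenvalue_of_ne_zero (hv : v ≠ 0) : cliffordEigenvalue v = 1 / (2 ^ n + 1) := by
  have h := sum_pairMoment (0 : Fin n → PauliLabel)
  simp only [pairMoment_zero_left, cliffordEigenvalue_zero] at h
  rw [← Finset.add_sum_erase _ _ (Finset.mem_univ 0), cliffordEigenvalue_zero,
    Finset.sum_congr rfl (fun w hw =>
      cliffordEigenvalue_eq_of_ne_zero (Finset.ne_of_mem_erase hw) hv),
    Finset.sum_const, nsmul_eq_mul, Finset.cast_card_erase_of_mem (Finset.mem_univ _),
    Finset.card_univ, card_pauliLabels] at h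
  obtain ⟨i, -⟩ := Function.ne_iff.1 hv
  have hd : (1 : ℝ) < 2 ^ n := one_lt_pow₀ (by norm_num) (by have := i.2; omega)
  rw [eq_div_iff (by positivity)]
  -- Counting gives `1 + (d² - 1) λ = d`. The factor `d - 1` can be cancelled because a nonzero
  -- label requires `n ≥ 1`.
  have h2 : ((2 : ℝ) ^ n - 1) * (cliffordEigenvalue v * (2 ^ n + 1)) = (2 ^ n - 1) * 1 := by
    linear_combination h
  exact mul_left_cancel₀ (by linarith) h2

/-- Adding 1 to the `X` exponent at qubit `i` exchanges the two classes of labels, so each is half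
of all `d²`. -/
theorem card_xFree_at (i : Fin n) :
    ((Finset.univ.filter fun w : Fin n → PauliLabel => (w i).2 = 0).card : ℝ) =
      2 ^ n * 2 ^ n / 2 := by
  have h : (Finset.univ.filter fun w : Fin n → PauliLabel => (w i).2 = 0).card =
      (Finset.univ.filter fun w : Fin n → PauliLabel => ¬ (w i).2 = 0).card := by
    have key : ∀ p : Fin 2, (p + 1 = 0 ↔ ¬ p = 0) := by decide
    refine Finset.card_equiv (Equiv.addRight (Pi.single i (0, 1))) fun w => ?_
    simp [key]
  have h2 := Finset.card_filter_add_card_filter_not (s := Finset.univ)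
    (fun w : Fin n → PauliLabel => (w i).2 = 0)
  rw [← h, Finset.card_univ] at h2
  have h3 := congrArg (Nat.cast : ℕ → ℝ) h2
  rw [card_pauliLabels] at h3
  push_cast at h3
  linarith

/-- Let `z` label `Z` on qubit `i`. Labels anticommuting with `z` have moment 0, the labels `0` and
`z` contribute `1/(d+1)` each, and the remaining `d²/2 - 2` commuting labels share a common moment
`m` by transitivity. The total is `d/(d+1)`, so `(d²/2 - 2) m = (d - 2)/(d + 1)`, that is `m =
2/((d+1)(d+2))`. -/
theorem pairMoment_single_le (i : Fin n) (hw0 : w ≠ 0) (hwi : w ≠ Pi.single i (1, 0)) :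
    pairMoment (Pi.single i (1, 0)) w ≤ 2 / ((2 ^ n + 1) * (2 ^ n + 2)) := by
  have hcases : ∀ p : Fin 2, p = 1 ∨ p = 0 := by decide
  set z : Fin n → PauliLabel := Pi.single i (1, 0) with hz
  have hzero : ∀ w' : Fin n → PauliLabel, (w' i).2 = 1 → pairMoment z w' = 0 := fun w' h =>
    Finset.sum_eq_zero fun g _ => by
      rw [(permutesPaulis_cliffordUnitary g).diagWeight_mul_eq_zero i w' h, mul_zero]
  rcases hcases (w i).2 with hx | hx
  · rw [hzero w hx]
    positivity
  have hzx : ∀ k, (z k).2 = 0 := fun k => by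
    by_cases hk : k = i
    · subst hk; simp [hz]
    · simp [hz, hk]
  have hz0 : z ≠ 0 := by simp [hz, Pi.single_eq_zero_iff]
  -- A label other than `0` and `z` with `1` or `Z` at qubit `i` must be nontrivial at some other
  -- qubit `j`, and reduces to `Z_j` with `z` fixed.
  have hexists : ∀ w' : Fin n → PauliLabel, (w' i).2 = 0 → w' ≠ 0 → w' ≠ z →
      ∃ j, z j = 0 ∧ pairMoment z w' = pairMoment z (Pi.single j (1, 0)) := by
    intro w' hx' h0 h1
    have : ∃ j, j ≠ i ∧ w' j ≠ 0 := by
      by_contra hc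
      push Not at hc
      have hl : ∀ l : PauliLabel, l.2 = 0 → l = 0 ∨ l = (1, 0) := by decide
      have hs : w' = Pi.single i (w' i) := by
        funext k
        by_cases hk : k = i
        · subst hk; simp
        · simp [hk, hc k hk]
      rcases hl _ hx' with h | h
      · exact h0 (by rw [hs, h, Pi.single_zero])
      · exact h1 (by rw [hs, h])
    obtain ⟨j, hji, hj⟩ := this
    refine ⟨j, by simp [hz, hji], ?_⟩
    refine (CliffordMoves.to_single hzx (fun k hk => ?_) (by simp [hz, hji]) hj).pairMoment_eq
    have : k = i := by
      by_contra h; exact hk (by simp [hz, h])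
    rw [this, hx']
  have hconst : ∀ w' : Fin n → PauliLabel, (w' i).2 = 0 → w' ≠ 0 → w' ≠ z →
      pairMoment z w' = pairMoment z w := by
    intro w' hx' h0 h1
    obtain ⟨j, hj, h⟩ := hexists w' hx' h0 h1
    obtain ⟨k, hk, h'⟩ := hexists w hx hw0 hwi
    rw [h, h', pairMoment_single hzx hj hk]
  have hsum := sum_pairMoment z
  set N := Finset.univ.filter fun w : Fin n → PauliLabel => (w i).2 = 0 with hN
  have hmem0 : (0 : Fin n → PauliLabel) ∈ N := by simp [hN]
  have hmemz : z ∈ N.erase 0 := by simp [hN, hzx, hz0]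
  have hmemw : w ∈ (N.erase 0).erase z := by simp [hN, hx, hw0, hwi]
  rw [← Finset.sum_subset (Finset.subset_univ N) (fun w' _ hw' => hzero w'
      ((hcases _).resolve_right (by simpa [hN] using hw'))),
    ← Finset.add_sum_erase _ _ hmem0, ← Finset.add_sum_erase _ _ hmemz,
    Finset.sum_congr rfl (fun w' hw' => hconst w'
      (by simpa [hN] using Finset.mem_of_mem_erase (Finset.mem_of_mem_erase hw'))
      (Finset.ne_of_mem_erase (Finset.mem_of_mem_erase hw')) (Finset.ne_of_mem_erase hw')),
    Finset.sum_const, nsmul_eq_mul, pairMoment_zero_right, pairMoment_self,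
    cliffordEigenvalue_of_ne_zero hz0] at hsum
  have hcard : ((((N.erase 0).erase z).card : ℕ) : ℝ) = 2 ^ n * 2 ^ n / 2 - 2 := by
    rw [Finset.cast_card_erase_of_mem hmemz, Finset.cast_card_erase_of_mem hmem0, hN,
      card_xFree_at]
    ring
  -- The label `w` itself lies in the class being counted, so the class is nonempty; this gives `d >
  -- 2` and permits cancelling `d - 2`.
  have hpos : (0 : ℝ) < ((((N.erase 0).erase z).card : ℕ) : ℝ) := by
    exact_mod_cast Finset.card_pos.2 ⟨w, hmemw⟩
  rw [hcard] at hsum hpos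
  have hd0 : (0 : ℝ) < 2 ^ n := by positivity
  generalize (2 : ℝ) ^ n = d at *
  have hd : 0 < d - 2 := by nlinarith
  refine le_of_eq ?_
  rw [eq_div_iff (by positivity)]
  field_simp at hsum
  exact mul_left_cancel₀ hd.ne' (by linear_combination hsum)

/-- Two distinct nontrivial Pauli operators are simultaneously diagonalized with probability at
most `2 / ((d + 1) (d + 2))`. -/
theorem pairMoment_le (hv : v ≠ 0) (hw : w ≠ 0) (hvw : v ≠ w) :
    pairMoment v w ≤ 2 / ((2 ^ n + 1) * (2 ^ n + 2)) := by
  obtain ⟨i, hi⟩ := Function.ne_iff.1 hv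
  obtain ⟨g, -, hg⟩ := CliffordMoves.to_single (v := 0) (w := v) (by simp) (by simp) rfl hi
  have hU := permutesPaulis_cliffordUnitary g
  obtain ⟨w', hw'⟩ := hU.moves w
  rw [CliffordMoves.pairMoment_eq ⟨g, hg, hw'⟩]
  -- After `v` is moved to `Z_i`, injectivity of the action keeps the image of `w` different from
  -- both `0` and `Z_i`.
  refine pairMoment_single_le i ?_ ?_
  · rintro rfl
    exact hw (hw'.eq_of_same_target hU.unitary hU.moves_zero)
  · rintro rfl
    exact hvw (hg.eq_of_same_target hU.unitary hw')

theorem cliffordEigenvalue_pos (v : Fin n → PauliLabel) : 0 < cliffordEigenvalue v := by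
  by_cases hv : v = 0
  · rw [hv, cliffordEigenvalue_zero]; exact one_pos
  · rw [cliffordEigenvalue_of_ne_zero hv]; positivity

end Moments

/-! ### Global Clifford sampling -/

section Global

variable {n : ℕ}

/-- The square expands into pair moments. Adding the off-diagonal constant on the diagonal too only
enlarges the bound and completes the sum to `(∑ t_a)²`. -/
theorem sum_pauli_coeff_sq_le (t : (Fin n → PauliLabel) → ℝ) (ht : ∀ a, 0 ≤ t a) (h0 : t 0 = 0) :
    ∑ g, uniformLaw (cliffordGroup n) g *
        (∑ a, t a * diagWeight (cliffordUnitary g) a) ^ 2 ≤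
      2 / ((2 ^ n + 1) * (2 ^ n + 2)) * (∑ a, t a) ^ 2 + 1 / (2 ^ n + 1) * ∑ a, t a ^ 2 := by
  have hexp : ∑ g, uniformLaw (cliffordGroup n) g *
        (∑ a, t a * diagWeight (cliffordUnitary g) a) ^ 2 =
      ∑ a, ∑ b, t a * t b * pairMoment a b := by
    simp only [pairMoment, sq, Finset.sum_mul_sum]
    simp only [Finset.mul_sum]
    rw [Finset.sum_comm]
    refine Finset.sum_congr rfl fun a _ => ?_
    rw [Finset.sum_comm]
    exact Finset.sum_congr rfl fun b _ => Finset.sum_congr rfl fun g _ => by ring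
  have hbound : ∀ a b, t a * t b * pairMoment a b ≤
      2 / ((2 ^ n + 1) * (2 ^ n + 2)) * (t a * t b) +
        if a = b then 1 / (2 ^ n + 1) * t a ^ 2 else 0 := by
    intro a b
    have hnn : 0 ≤ 2 / (((2 : ℝ) ^ n + 1) * (2 ^ n + 2)) * (t a * t b) :=
      mul_nonneg (by positivity) (mul_nonneg (ht a) (ht b))
    by_cases ha : a = 0
    · subst ha
      simp [h0]
    by_cases hb : b = 0
    · subst hb
      simp [h0, ha]
    by_cases hab : a = b
    · subst hab
      rw [if_pos rfl, pairMoment_self, cliffordEigenvalue_of_ne_zero ha]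
      linarith
    · rw [if_neg hab, add_zero, mul_comm]
      exact mul_le_mul_of_nonneg_right (pairMoment_le ha hb hab) (mul_nonneg (ht a) (ht b))
  rw [hexp]
  refine (Finset.sum_le_sum fun a _ => Finset.sum_le_sum fun b _ => hbound a b).trans
    (le_of_eq ?_)
  simp only [Finset.sum_add_distrib, Finset.sum_ite_eq, Finset.mem_univ, if_true,
    ← Finset.mul_sum, sq, Finset.sum_mul_sum]

theorem hsInner_zero_tracelessPart (O : Op n) : hsInner (pauli 0) (tracelessPart O) = 0 := by
  rw [pauli_zero, hsInner, Matrix.conjTranspose_one, one_mul, tracelessPart, Matrix.trace_sub,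
    Matrix.trace_smul, Matrix.trace_one]
  simp

theorem shadowVariance_clifford_le {Λ : cliffordGroup n → SuperOp n}
    (hΛ : ∀ g, IsQuantumChannel (Λ g)) {ρ : Op n} (hρ : IsState ρ) (O : Op n) :
    shadowVariance (uniformLaw (cliffordGroup n)) cliffordUnitary Λ ρ O ≤
      2 * ((2 : ℝ) ^ n + 1) / ((2 : ℝ) ^ n + 2) * stabilizerNorm (tracelessPart O) ^ 2 +
        ((2 : ℝ) ^ n + 1) / (2 : ℝ) ^ n * hsNorm (tracelessPart O) ^ 2 := by
  set o : (Fin n → PauliLabel) → ℂ := fun a => hsInner (pauli a) (tracelessPart O) with ho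
  have ho0 : o 0 = 0 := hsInner_zero_tracelessPart O
  set c : ℂ := O.trace / 2 ^ n with hc
  -- The Pauli coefficient `|o_a|/d` multiplied by the inverse eigenvalue `d + 1`.
  set t : (Fin n → PauliLabel) → ℝ := fun a => (2 ^ n + 1) / 2 ^ n * ‖o a‖ with ht
  have hO : O = tracelessPart O + c • pauli 0 := by rw [tracelessPart, pauli_zero]; simp [hc]
  -- The identity component contributes the constant `star c` to the estimator; centring there
  -- leaves only the traceless part.
  have hest : ∀ (g : cliffordGroup n) x,
      ‖estimator (uniformLaw (cliffordGroup n)) cliffordUnitary O g x - star c‖ ≤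
        ∑ a, t a * diagWeight (cliffordUnitary g) a := by
    intro g x
    have hlin : estimator (uniformLaw (cliffordGroup n)) cliffordUnitary O g x - star c =
        estimator (uniformLaw (cliffordGroup n)) cliffordUnitary
          (∑ a, (o a / 2 ^ n) • pauli a) g x := by
      have h0 := estimator_sum_pauli (p := uniformLaw (cliffordGroup n))
        permutesPaulis_cliffordUnitary (fun a => (cliffordEigenvalue_pos a).ne')
        {()} (fun _ => c) (fun _ => 0) g x
      simp only [Finset.sum_singleton, cliffordEigenvalue_zero, pauli_zero, mul_one,
        (permutesPaulis_cliffordUnitary g).unitary', Matrix.one_apply_eq, star_one,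
        Complex.ofReal_one, inv_one] at h0
      rw [← pauli_expansion (tracelessPart O), ← h0, sub_eq_iff_eq_add]
      conv_lhs => rw [hO]
      simp only [estimator, hsInner, Matrix.conjTranspose_add, Matrix.add_mul, Matrix.trace_add,
        pauli_zero]
    rw [hlin]
    refine (norm_estimator_sum_pauli_le permutesPaulis_cliffordUnitary cliffordEigenvalue_pos
      _ _ _ g x).trans (le_of_eq (Finset.sum_congr rfl fun a _ => ?_))
    by_cases ha : a = 0
    · subst ha
      simp [ht, ho0]
    · change _ * ((cliffordEigenvalue a)⁻¹ * _) = _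
      rw [cliffordEigenvalue_of_ne_zero ha, ht, norm_div, norm_pow]
      simp
      ring
  refine (shadowVariance_le (uniformLaw_nonneg _) (sum_uniformLaw _)
    permutesPaulis_cliffordUnitary hΛ hρ O (star c) _ hest).trans ?_
  refine (sum_pauli_coeff_sq_le t (fun a => by positivity) (by simp [ht, ho0])).trans
    (le_of_eq ?_)
  have h1 : ∑ a, t a = (2 ^ n + 1) * stabilizerNorm (tracelessPart O) := by
    simp only [ht, ho, stabilizerNorm, ← Finset.mul_sum]
    ring
  have h2 : ∑ a, t a ^ 2 = (2 ^ n + 1) ^ 2 / 2 ^ n * hsNorm (tracelessPart O) ^ 2 := by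
    simp only [ht, ho, mul_pow, ← Finset.mul_sum, sum_norm_sq_hsInner_pauli]
    field_simp
  rw [h1, h2]
  field_simp

end Global

/-! ### Local Clifford unitaries -/

/-- The identification of operators on one qubit with `2 × 2` matrices. -/
def siteMatrix (A : Op 1) : Matrix (Fin 2) (Fin 2) ℂ :=
  Matrix.of fun s t => A (fun _ => s) (fun _ => t)

theorem siteMatrix_mul (A B : Op 1) : siteMatrix (A * B) = siteMatrix A * siteMatrix B := by
  ext s t
  simp only [siteMatrix, Matrix.of_apply, Matrix.mul_apply]
  exact Fintype.sum_equiv (Equiv.funUnique (Fin 1) (Fin 2)) _ _ fun x => by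
    have hx : x = fun _ => x 0 := funext fun i => by rw [Subsingleton.elim i 0]
    conv_lhs => rw [hx]
    rfl

theorem siteMatrix_conjTranspose (A : Op 1) : siteMatrix Aᴴ = (siteMatrix A)ᴴ := rfl

theorem siteMatrix_one : siteMatrix 1 = 1 := by
  ext s t
  simp [siteMatrix, Matrix.one_apply, funext_iff]

theorem siteMatrix_pauli (a : Fin 1 → PauliLabel) : siteMatrix (pauli a) = pauli1 (a 0) := by
  ext s t
  simp [siteMatrix, pauli, tensorOp]

theorem localCliffordUnitary_eq {n : ℕ} (g : LocalClifford n) :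
    localCliffordUnitary g = tensorOp fun i => siteMatrix (cliffordUnitary (g i)) := rfl

theorem siteMatrix_conj_pauli (U : Op 1) (l : PauliLabel) :
    siteMatrix U * pauli1 l * (siteMatrix U)ᴴ = siteMatrix (U * pauli (fun _ => l) * Uᴴ) := by
  rw [siteMatrix_mul, siteMatrix_mul, siteMatrix_conjTranspose, siteMatrix_pauli]

theorem permutesPaulis_localCliffordUnitary {n : ℕ} (g : LocalClifford n) :
    PermutesPaulis (localCliffordUnitary g) := by
  refine ⟨?_, fun a => ?_⟩
  · rw [localCliffordUnitary_eq, tensorOp_conjTranspose, tensorOp_mul]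
    simp only [← siteMatrix_conjTranspose, ← siteMatrix_mul,
      (permutesPaulis_cliffordUnitary _).unitary, siteMatrix_one, tensorOp_one]
  · choose b hb using fun i => (permutesPaulis_cliffordUnitary (g i)).moves (fun _ => a i)
    refine ⟨fun i => b i 0, PauliMoves.tensorOp fun i => ?_⟩
    obtain ⟨c, hc, h⟩ := hb i
    refine ⟨c, hc, ?_⟩
    change siteMatrix _ * _ * (siteMatrix _)ᴴ = _
    rw [siteMatrix_conj_pauli, h, ← siteMatrix_pauli]
    rfl

/-- The diagonal weight of a single-qubit Pauli operator. -/
noncomputable def siteWeight (g : cliffordGroup 1) (l : PauliLabel) : ℝ :=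
  diagWeight (cliffordUnitary g) fun _ => l

/-- The eigenvalue of the frame operator of the single-qubit Clifford group. -/
noncomputable def siteEigenvalue (l : PauliLabel) : ℝ := if l = 0 then 1 else 1 / 3

theorem siteEigenvalue_pos (l : PauliLabel) : 0 < siteEigenvalue l := by
  unfold siteEigenvalue; split_ifs <;> norm_num

theorem siteEigenvalue_zero : siteEigenvalue 0 = 1 := if_pos rfl

theorem siteWeight_zero (g : cliffordGroup 1) : siteWeight g 0 = 1 :=
  (permutesPaulis_cliffordUnitary g).diagWeight_zero

/-- The one-qubit case of the global eigenvalue: `1/(d+1) = 1/3` for `d = 2`. -/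
theorem sum_uniformLaw_mul_siteWeight (l : PauliLabel) :
    ∑ g, uniformLaw (cliffordGroup 1) g * siteWeight g l = siteEigenvalue l := by
  change cliffordEigenvalue (fun _ : Fin 1 => l) = _
  by_cases hl : l = 0
  · subst hl
    exact cliffordEigenvalue_zero.trans siteEigenvalue_zero.symm
  · rw [cliffordEigenvalue_of_ne_zero fun h => hl (congrFun h 0), siteEigenvalue, if_neg hl]
    norm_num

theorem sum_siteWeight (g : cliffordGroup 1) : ∑ l, siteWeight g l = 2 := by
  have h := (permutesPaulis_cliffordUnitary g).sum_diagWeight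
  rw [pow_one] at h
  rw [← h]
  refine (Fintype.sum_equiv (Equiv.funUnique (Fin 1) PauliLabel) _ _ fun a => ?_).symm
  have ha : a = fun _ => a 0 := funext fun i => by rw [Subsingleton.elim i 0]
  conv_lhs => rw [ha]
  rfl

/-- The identity has weight 1, and the nontrivial labels have total weight `2 - 1 = 1`, scaled by 3:
`1 + 3 = 4`. This holds for each `g`, not only on average. -/
theorem sum_inv_siteEigenvalue_mul_siteWeight (g : cliffordGroup 1) :
    ∑ l, (siteEigenvalue l)⁻¹ * siteWeight g l = 4 := by
  have h := sum_siteWeight g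
  rw [← Finset.add_sum_erase _ _ (Finset.mem_univ 0), siteWeight_zero] at h
  rw [← Finset.add_sum_erase _ _ (Finset.mem_univ 0), siteEigenvalue_zero, siteWeight_zero,
    Finset.sum_congr rfl (g := fun l => 3 * siteWeight g l) (fun l hl => by
      rw [siteEigenvalue, if_neg (Finset.ne_of_mem_erase hl)]; norm_num), ← Finset.mul_sum]
  linarith

theorem diagWeight_localCliffordUnitary {n : ℕ} (g : LocalClifford n) (a : Fin n → PauliLabel) :
    diagWeight (localCliffordUnitary g) a = ∏ i, siteWeight (g i) (a i) := by
  rw [diagWeight, localCliffordUnitary_eq, tensorOp_conjTranspose, pauli, tensorOp_mul,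
    tensorOp_mul]
  simp only [siteMatrix_conj_pauli, tensorOp, Matrix.of_apply, norm_prod]
  rfl

theorem uniformLaw_localClifford {n : ℕ} (g : LocalClifford n) :
    uniformLaw (LocalClifford n) g = ∏ i, uniformLaw (cliffordGroup 1) (g i) := by
  simp [uniformLaw]

/-- The sites are independent under the uniform law, so the mean of the product of weights is the
product of the means. -/
theorem frameEigenvalue_localClifford {n : ℕ} (a : Fin n → PauliLabel) :
    frameEigenvalue (uniformLaw (LocalClifford n)) localCliffordUnitary a =
      ∏ i, siteEigenvalue (a i) := by
  simp only [frameEigenvalue, uniformLaw_localClifford, diagWeight_localCliffordUnitary,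
    ← Finset.prod_mul_distrib, ← sum_uniformLaw_mul_siteWeight]
  rw [Finset.prod_univ_sum, Fintype.piFinset_univ]

theorem frameEigenvalue_localClifford_pos {n : ℕ} (a : Fin n → PauliLabel) :
    0 < frameEigenvalue (uniformLaw (LocalClifford n)) localCliffordUnitary a := by
  rw [frameEigenvalue_localClifford]
  exact Finset.prod_pos fun i _ => siteEigenvalue_pos _

/-! ### Local Clifford sampling -/

section Local

variable {n : ℕ} {Λ : LocalClifford n → SuperOp n} {ρ : Op n}

theorem shadowVariance_localClifford_pauli_le (hΛ : ∀ g, IsQuantumChannel (Λ g)) (hρ : IsState ρ)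
    (a : Fin n → PauliLabel) :
    shadowVariance (uniformLaw (LocalClifford n)) localCliffordUnitary Λ ρ (pauli a) ≤
      (3 : ℝ) ^ (pauliSupport a).card := by
  have hl := frameEigenvalue_localClifford_pos a
  have hest : ∀ (g : LocalClifford n) x,
      ‖estimator (uniformLaw (LocalClifford n)) localCliffordUnitary (pauli a) g x - 0‖ ≤
        (frameEigenvalue (uniformLaw (LocalClifford n)) localCliffordUnitary a)⁻¹ *
          diagWeight (localCliffordUnitary g) a := by
    intro g x
    simpa using norm_estimator_sum_pauli_le permutesPaulis_localCliffordUnitary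
      frameEigenvalue_localClifford_pos {()} (fun _ => 1) (fun _ => a) g x
  refine (shadowVariance_le (uniformLaw_nonneg _) (sum_uniformLaw _)
    permutesPaulis_localCliffordUnitary hΛ hρ _ 0 _ hest).trans (le_of_eq ?_)
  set l := frameEigenvalue (uniformLaw (LocalClifford n)) localCliffordUnitary a with hldef
  -- The weight takes values 0 and 1, so its second moment equals its mean `l`, and the bound
  -- becomes `l⁻¹`.
  have h1 : ∑ g, uniformLaw (LocalClifford n) g *
      (l⁻¹ * diagWeight (localCliffordUnitary g) a) ^ 2 = l⁻¹ ^ 2 * l := by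
    have h0 : l = ∑ g, uniformLaw (LocalClifford n) g * diagWeight (localCliffordUnitary g) a := rfl
    conv_rhs => arg 2; rw [h0]
    rw [Finset.mul_sum]
    refine Finset.sum_congr rfl fun g _ => ?_
    rw [mul_pow, (permutesPaulis_localCliffordUnitary g).diagWeight_sq]
    ring
  rw [h1, sq, mul_assoc, inv_mul_cancel₀ hl.ne', mul_one, hldef, frameEigenvalue_localClifford,
    ← Finset.prod_inv_distrib]
  have h2 : ∀ m : PauliLabel, (siteEigenvalue m)⁻¹ = if m ≠ (0, 0) then 3 else 1 := fun m => by
    by_cases hm : m = (0, 0)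
    · rw [if_neg (not_not.2 hm), hm]
      exact (congrArg _ siteEigenvalue_zero).trans inv_one
    · rw [siteEigenvalue, if_neg (show ¬ m = 0 from hm), if_pos hm]; norm_num
  simp only [h2]
  rw [Finset.prod_ite, Finset.prod_const, Finset.prod_const_one, mul_one, pauliSupport]

/-- The Pauli label equal to `b` on the qubits `e j` and trivial elsewhere. -/
noncomputable def extendLabel {k n : ℕ} (e : Fin k ↪ Fin n) (b : Fin k → PauliLabel) :
    Fin n → PauliLabel := Function.extend e b 0

/-- Qubits outside the range of `e` carry the trivial label and contribute a factor 1. This reduces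
eigenvalues, weights and matrix entries to products over the `k` chosen qubits. -/
theorem prod_extendLabel {k : ℕ} (e : Fin k ↪ Fin n) (b : Fin k → PauliLabel)
    {M : Type*} [CommMonoid M] (f : Fin n → PauliLabel → M)
    (hf : ∀ i ∉ Set.range e, f i 0 = 1) :
    ∏ i, f i (extendLabel e b i) = ∏ j, f (e j) (b j) := by
  refine (Fintype.prod_of_injective e e.injective _ _ (fun i hi => ?_) fun j => ?_).symm
  · rw [extendLabel, Function.extend_apply' _ _ _ hi]
    exact hf i hi
  · rw [extendLabel, e.injective.extend_apply]

theorem localOp_pauli {k : ℕ} (e : Fin k ↪ Fin n) (b : Fin k → PauliLabel) :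
    localOp e (pauli b) = pauli (extendLabel e b) := by
  classical
  ext x y
  simp only [localOp, pauli, tensorOp, Matrix.of_apply]
  split_ifs with h
  · rw [prod_extendLabel e b fun i l => pauli1 l (x i) (y i)]
    intro i hi
    rw [pauli1_zero, h i hi, Matrix.one_apply_eq]
  · push Not at h
    obtain ⟨i, hi, hxy⟩ := h
    refine (Finset.prod_eq_zero (Finset.mem_univ i) ?_).symm
    rw [extendLabel, Function.extend_apply' _ _ _ hi, Pi.zero_apply, pauli1_zero,
      Matrix.one_apply_ne hxy]

theorem localOp_sum_smul {k : ℕ} (e : Fin k ↪ Fin n) {ι : Type*} (s : Finset ι) (c : ι → ℂ)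
    (A : ι → Op k) : localOp e (∑ i ∈ s, c i • A i) = ∑ i ∈ s, c i • localOp e (A i) := by
  classical
  ext x y
  simp only [localOp, Matrix.sum_apply, Matrix.smul_apply, Matrix.of_apply]
  split_ifs <;> simp

/-- Each of the `2^k` columns is the image of a unit basis vector, so its length is at most the
operator norm. -/
theorem hsNorm_sq_le {k : ℕ} (A : Op k) : hsNorm A ^ 2 ≤ 2 ^ k * spectralNormOp A ^ 2 := by
  have hcol : ∀ y, ∑ x, ‖A x y‖ ^ 2 ≤ spectralNormOp A ^ 2 := by
    intro y
    have h := (Matrix.toEuclideanCLM (n := Bits k) (𝕜 := ℂ) A).le_opNorm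
      (EuclideanSpace.single y 1)
    rw [PiLp.norm_single, norm_one, mul_one] at h
    have h2 := pow_le_pow_left₀ (norm_nonneg _) h 2
    rw [EuclideanSpace.norm_sq_eq] at h2
    simpa [Matrix.ofLp_toEuclideanCLM, spectralNormOp] using h2
  rw [hsNorm_sq, Finset.sum_comm]
  refine (Finset.sum_le_sum fun y _ => hcol y).trans (le_of_eq ?_)
  simp

theorem shadowVariance_localClifford_localOp_le (hΛ : ∀ g, IsQuantumChannel (Λ g))
    (hρ : IsState ρ) {k : ℕ} (e : Fin k ↪ Fin n) (A : Op k) :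
    shadowVariance (uniformLaw (LocalClifford n)) localCliffordUnitary Λ ρ (localOp e A) ≤
      (4 : ℝ) ^ k * spectralNormOp A ^ 2 := by
  set l : (Fin k → PauliLabel) → ℝ := fun b =>
    frameEigenvalue (uniformLaw (LocalClifford n)) localCliffordUnitary (extendLabel e b) with hl
  set z : LocalClifford n → (Fin k → PauliLabel) → ℝ := fun g b =>
    diagWeight (localCliffordUnitary g) (extendLabel e b) with hz
  set t : (Fin k → PauliLabel) → ℝ := fun b => ‖hsInner (pauli b) A / 2 ^ k‖ with ht
  have hlpos : ∀ b, 0 < l b := fun b => frameEigenvalue_localClifford_pos _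
  have hznn : ∀ g b, 0 ≤ (l b)⁻¹ * z g b := fun g b =>
    mul_nonneg (inv_nonneg.2 (hlpos b).le) (diagWeight_nonneg _ _)
  have hexp : localOp e A =
      ∑ b, (hsInner (pauli b) A / 2 ^ k) • pauli (extendLabel e b) := by
    conv_lhs => rw [pauli_expansion A, localOp_sum_smul]
    simp only [localOp_pauli]
  have hest : ∀ (g : LocalClifford n) x,
      ‖estimator (uniformLaw (LocalClifford n)) localCliffordUnitary (localOp e A) g x - 0‖ ≤
        ∑ b, t b * ((l b)⁻¹ * z g b) := by
    intro g x
    rw [sub_zero, hexp]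
    exact norm_estimator_sum_pauli_le permutesPaulis_localCliffordUnitary
      frameEigenvalue_localClifford_pos _ _ _ g x
  -- The sum factors over the `k` qubits, with a factor 4 from each.
  have hweights : ∀ g, ∑ b, (l b)⁻¹ * z g b = 4 ^ k := by
    intro g
    have h1 : ∀ b, (l b)⁻¹ * z g b =
        ∏ j, (siteEigenvalue (b j))⁻¹ * siteWeight (g (e j)) (b j) := by
      intro b
      simp only [hl, hz]
      rw [frameEigenvalue_localClifford, diagWeight_localCliffordUnitary,
        prod_extendLabel e b (fun _ => siteEigenvalue) (fun _ _ => siteEigenvalue_zero),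
        prod_extendLabel e b (fun i => siteWeight (g i)) (fun i _ => siteWeight_zero (g i)),
        ← Finset.prod_inv_distrib, ← Finset.prod_mul_distrib]
    simp only [h1]
    rw [← Fintype.piFinset_univ, ← Finset.prod_univ_sum (fun _ => Finset.univ)
      (fun j m => (siteEigenvalue m)⁻¹ * siteWeight (g (e j)) m)]
    simp [sum_inv_siteEigenvalue_mul_siteWeight]
  -- Cauchy-Schwarz with the weights `(l b)⁻¹ * z g b`, whose total is `4 ^ k` for every `g`.
  have hcs : ∀ g, (∑ b, t b * ((l b)⁻¹ * z g b)) ^ 2 ≤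
      4 ^ k * ∑ b, t b ^ 2 * ((l b)⁻¹ * z g b) := by
    intro g
    rw [← hweights g]
    exact Finset.sum_sq_le_sum_mul_sum_of_sq_le_mul _ (fun b _ => hznn g b)
      (fun b _ => mul_nonneg (sq_nonneg _) (hznn g b)) fun b _ => le_of_eq (by ring)
  refine (shadowVariance_le (uniformLaw_nonneg _) (sum_uniformLaw _)
    permutesPaulis_localCliffordUnitary hΛ hρ _ 0 _ hest).trans ?_
  calc _ ≤ ∑ g, uniformLaw (LocalClifford n) g *
        (4 ^ k * ∑ b, t b ^ 2 * ((l b)⁻¹ * z g b)) :=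
        Finset.sum_le_sum fun g _ => mul_le_mul_of_nonneg_left (hcs g) (uniformLaw_nonneg _ g)
    -- Averaging over `g` replaces `z g b` by its mean `l b`, which cancels the inverse eigenvalue
    -- and leaves a Parseval sum.
    _ = 4 ^ k * ∑ b, t b ^ 2 * ((l b)⁻¹ * l b) := by
        have h2 : ∀ b, t b ^ 2 * ((l b)⁻¹ * l b) =
            ∑ g, uniformLaw (LocalClifford n) g * (t b ^ 2 * ((l b)⁻¹ * z g b)) := by
          intro b
          have h3 : l b = ∑ g, uniformLaw (LocalClifford n) g * z g b := rfl
          conv_lhs => rw [← mul_assoc, h3, Finset.mul_sum]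
          refine Finset.sum_congr rfl fun g _ => ?_
          rw [← h3]
          ring
        simp only [h2]
        rw [Finset.sum_comm, Finset.mul_sum]
        refine Finset.sum_congr rfl fun g _ => ?_
        rw [← Finset.mul_sum]
        ring
    _ = 4 ^ k * (hsNorm A ^ 2 / 2 ^ k) := by
        have h4 : ∑ b, t b ^ 2 = hsNorm A ^ 2 / 2 ^ k := by
          simp only [ht, norm_div, div_pow, ← Finset.sum_div, sum_norm_sq_hsInner_pauli, norm_pow,
            Complex.norm_ofNat]
          field_simp
        rw [← h4]
        congr 1
        exact Finset.sum_congr rfl fun b _ => by rw [inv_mul_cancel₀ (hlpos b).ne', mul_one]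
    _ ≤ 4 ^ k * spectralNormOp A ^ 2 := by
        refine mul_le_mul_of_nonneg_left ?_ (by positivity)
        rw [div_le_iff₀ (by positivity), mul_comm]
        exact hsNorm_sq_le A

end Local

theorem theorem2 (n : ℕ) :
    -- uniform sampling from the global Clifford group
    (IsUnit (frameOperator (uniformLaw (cliffordGroup n)) (cliffordUnitary (n := n))) ∧
      ∀ (Λ : cliffordGroup n → SuperOp n), (∀ g, IsQuantumChannel (Λ g)) →
      ∀ (ρ : Op n), IsState ρ →
      ∀ (O : Op n), O.IsHermitian →
        shadowVariance (uniformLaw (cliffordGroup n)) cliffordUnitary Λ ρ O ≤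
          2 * ((2 : ℝ) ^ n + 1) / ((2 : ℝ) ^ n + 2) * stabilizerNorm (tracelessPart O) ^ 2 +
            ((2 : ℝ) ^ n + 1) / (2 : ℝ) ^ n * hsNorm (tracelessPart O) ^ 2) ∧
    -- uniform sampling from the local Clifford group
    (IsUnit (frameOperator (uniformLaw (LocalClifford n)) (localCliffordUnitary (n := n))) ∧
      ∀ (Λ : LocalClifford n → SuperOp n), (∀ g, IsQuantumChannel (Λ g)) →
      ∀ (ρ : Op n), IsState ρ →
        -- observables acting on `k` qubits
        (∀ (k : ℕ) (e : Fin k ↪ Fin n) (Oloc : Op k), Oloc.IsHermitian →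
          shadowVariance (uniformLaw (LocalClifford n)) localCliffordUnitary Λ ρ
            (localOp e Oloc) ≤ (4 : ℝ) ^ k * spectralNormOp Oloc ^ 2) ∧
        -- Pauli observables
        (∀ a : Fin n → PauliLabel,
          shadowVariance (uniformLaw (LocalClifford n)) localCliffordUnitary Λ ρ (pauli a) ≤
            (3 : ℝ) ^ (pauliSupport a).card)) := by
  refine ⟨⟨?_, fun Λ hΛ ρ hρ O _ => shadowVariance_clifford_le hΛ hρ O⟩, ?_,
    fun Λ hΛ ρ hρ => ⟨fun k e A _ => shadowVariance_localClifford_localOp_le hΛ hρ e A,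
      shadowVariance_localClifford_pauli_le hΛ hρ⟩⟩
  · exact isUnit_frameOperator permutesPaulis_cliffordUnitary
      fun a => (cliffordEigenvalue_pos a).ne'
  · exact isUnit_frameOperator permutesPaulis_localCliffordUnitary
      fun a => (frameEigenvalue_localClifford_pos a).ne'
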